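/- Let $N\ge 1$, $s\in(0,1)$, $2\le p<\infty$ with $N>sp$, and let $\Omega\subset\mathbb R^N$ be a nonempty bounded open set (for instance a bounded domain with Lipschitz boundary). Put $$[u]_{s,p}^p=\int_{\mathbb R^N}\!\int_{\mathbb R^N}\frac{|u(x)-u(y)|^p}{|x-y|^{N+sp}}\,dy\,dx,\qquad \|u\|_p^p=\int_\Omega|u|^p\,dx,$$ let $W_0^{s,p}(\Omega)$ be the space of all $u\in L^p(\mathbb R^N)$ with $[u]_{s,p}<\infty$ and $u=0$ a.e. in $\mathbb R^N\setminus\Omega$, and let $X_0=W_0^{s,p}(\Omega)\setminus\{0\}$. For $u\in W_0^{s,p}(\Omega)$ define (with $|u|^p\log|u|=0$ where $u=0$) $$E(u)=\frac1p[u]_{s,p}^p+\frac1p\|u\|_p^p-\frac1p\int_\Omega|u|^p\log|u|\,dx+\frac1{p^2}\|u\|_p^p,$$ $$I(u)=[u]_{s,p}^p+\|u\|_p^p-\int_\Omega|u|^p\log|u|\,dx,$$ and let $\mathcal N=\{u\in X_0: I(u)=0\}$ and $d=\inf_{u\in\mathcal N}E(u)$. Then the following hold. 1. $\displaystyle d=\inf_{u\in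 X_0}\ \sup_{\lambda>0}E(\lambda u).$ 2. Let $0<\varrho<\frac{sp^2}{N}$, let $\theta$ be given by $\frac1{p+\varrho}=\frac{1-\theta}{p}+\frac{\theta}{p_s^*}$ with $p_s^*=\frac{Np}{N-sp}$, and let $\gamma=\frac{(1-\theta)(p+\varrho)}{p-\theta(p+\varrho)}$. There is a constant $C>0$ such that $$\int_\Omega|u|^p\log|u|\,dx\le\frac12[u]_{s,p}^p+C\big(\|u\|_p^p\big)^{\gamma}\qquad\text{for all }u\in X_0,$$ and for every such $C$, with $R=(1/C)^{\frac1{p(\gamma-1)}}$, $$d\ge M:=\frac{R^p}{p^2}>0.$$ 3. There is $u\in\mathcal N$ with $E(u)=d$ which is a critical point of $E$, that is, $\frac{d}{dt}E(u+tv)\big|_{t=0}=0$ for all $v\in W_0^{s,p}(\Omega)$, and which is a ground state of the stationary problem $(-\Delta)_p^su+|u|^{p-2}u=|u|^{p-2}u\log|u|$ in $\Omega$, $u=0$ in $\mathbb R^N\setminus\Omega$. This means that for all $v\in W_0^{s,p}(\Omega)$ $$\int_{\mathbb R^N}\!\int_{\mathbb R^N}\frac{|u(x)-u(y)|^{p-2}(u(x)-u(y))(v(x)-v(y))}{|x-y|^{N+sp}}\,dy\,dx+\int_\Omega|u|^{p-2}uv\,dx=\int_\Omega|u|^{p-2}u\log|u|\,v\,dx,$$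 and that $E(u)\le E(w)$ for every $w\in X_0$ that satisfies the same identity for all $v\in W_0^{s,p}(\Omega)$. -/

import Mathlib

open MeasureTheory

noncomputable section

namespace FracLog

/-- The `p`-th power `[u]_{s,p}^p` of the Gagliardo seminorm, as an extended nonnegative number:
the double integral over `ℝ^N × ℝ^N` of `|u x - u y|^p / |x - y|^(N + s p)`. -/
def gagliardoPow (N : ℕ) (s p : ℝ) (u : EuclideanSpace ℝ (Fin N) → ℝ) : ENNReal :=
  ∫⁻ x, ∫⁻ y, ENNReal.ofReal (|u x - u y| ^ p / ‖x - y‖ ^ ((N : ℝ) + s * p))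

/-- The space `W_0^{s,p}(Ω)`: functions on `ℝ^N` that vanish almost everywhere outside `Ω`, lie in
`L^p`, and have finite Gagliardo seminorm. Functions that agree almost everywhere represent the
same element; every notion below is invariant under such a change. -/
def W0 {N : ℕ} (Ω : Set (EuclideanSpace ℝ (Fin N))) (s p : ℝ) :
    Set (EuclideanSpace ℝ (Fin N) → ℝ) :=
  {u | MemLp u (ENNReal.ofReal p) volume ∧ gagliardoPow N s p u < ⊤ ∧
    ∀ᵐ x ∂(volume : Measure (EuclideanSpace ℝ (Fin N))), x ∉ Ω → u x = 0}

/-- `X_0 = W_0^{s,p}(Ω) \ {0}`. -/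
def X0 {N : ℕ} (Ω : Set (EuclideanSpace ℝ (Fin N))) (s p : ℝ) :
    Set (EuclideanSpace ℝ (Fin N) → ℝ) :=
  {u | u ∈ W0 Ω s p ∧ ¬ (∀ᵐ x ∂(volume : Measure (EuclideanSpace ℝ (Fin N))), u x = 0)}

/-- `‖u‖_p^p`, the integral of `|u|^p` over `Ω`. -/
def normPow {N : ℕ} (Ω : Set (EuclideanSpace ℝ (Fin N))) (p : ℝ)
    (u : EuclideanSpace ℝ (Fin N) → ℝ) : ℝ :=
  ∫ x in Ω, |u x| ^ p

/-- The integral of `|u|^p log |u|` over `Ω` (the integrand is `0` where `u = 0`). -/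
def logTerm {N : ℕ} (Ω : Set (EuclideanSpace ℝ (Fin N))) (p : ℝ)
    (u : EuclideanSpace ℝ (Fin N) → ℝ) : ℝ :=
  ∫ x in Ω, |u x| ^ p * Real.log |u x|

/-- The energy functional `E`. -/
def energy {N : ℕ} (Ω : Set (EuclideanSpace ℝ (Fin N))) (s p : ℝ)
    (u : EuclideanSpace ℝ (Fin N) → ℝ) : ℝ :=
  1 / p * (gagliardoPow N s p u).toReal + 1 / p * normPow Ω p u - 1 / p * logTerm Ω p u
    + 1 / p ^ 2 * normPow Ω p u

/-- The Nehari functional `I`. -/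
def nehariFunctional {N : ℕ} (Ω : Set (EuclideanSpace ℝ (Fin N))) (s p : ℝ)
    (u : EuclideanSpace ℝ (Fin N) → ℝ) : ℝ :=
  (gagliardoPow N s p u).toReal + normPow Ω p u - logTerm Ω p u

/-- The Nehari manifold: all `u ∈ X_0` with `I(u) = 0`. -/
def nehari {N : ℕ} (Ω : Set (EuclideanSpace ℝ (Fin N))) (s p : ℝ) :
    Set (EuclideanSpace ℝ (Fin N) → ℝ) :=
  {u | u ∈ X0 Ω s p ∧ nehariFunctional Ω s p u = 0}

/-- The depth `d` of the potential well, the infimum of `E` over the Nehari manifold. It is taken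
in the extended reals, so that no convention for empty or unbounded sets enters. -/
def depth {N : ℕ} (Ω : Set (EuclideanSpace ℝ (Fin N))) (s p : ℝ) : EReal :=
  ⨅ u ∈ nehari Ω s p, (energy Ω s p u : EReal)

/-- The constant `C > 0` is admissible for the logarithmic estimate with parameters `ε` and `γ`:
`∫_Ω |u|^p log |u| ≤ ε [u]_{s,p}^p + C (‖u‖_p^p)^γ` for all `u ∈ X_0`. -/
def LogEstimate {N : ℕ} (Ω : Set (EuclideanSpace ℝ (Fin N))) (s p ε γ C : ℝ) : Prop :=
  0 < C ∧ ∀ u ∈ X0 Ω s p,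
    logTerm Ω p u ≤ ε * (gagliardoPow N s p u).toReal + C * normPow Ω p u ^ γ

/-- The radius `R = (1 / C)^(1 / (p (γ - 1)))`. -/
def radius (p γ C : ℝ) : ℝ := (1 / C) ^ (1 / (p * (γ - 1)))

/-- The form `K^{s,p}(u, v)`, the weak form of the fractional `p`-Laplacian. -/
def formK (N : ℕ) (s p : ℝ) (u v : EuclideanSpace ℝ (Fin N) → ℝ) : ℝ :=
  ∫ x, ∫ y, |u x - u y| ^ (p - 2) * (u x - u y) / ‖x - y‖ ^ ((N : ℝ) + s * p) * (v x - v y)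

/-- `u` is a critical point of `E`: the directional derivative of `E` at `u` exists and vanishes
in every direction `v ∈ W_0^{s,p}(Ω)`. -/
def IsCriticalPoint {N : ℕ} (Ω : Set (EuclideanSpace ℝ (Fin N))) (s p : ℝ)
    (u : EuclideanSpace ℝ (Fin N) → ℝ) : Prop :=
  u ∈ W0 Ω s p ∧
    ∀ v ∈ W0 Ω s p, HasDerivAt (fun t : ℝ => energy Ω s p (u + t • v)) 0 0

/-- `u` is a weak solution of the stationary problem
`(-Δ)_p^s u + |u|^(p-2) u = |u|^(p-2) u log |u|` in `Ω`, `u = 0` outside `Ω`. -/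
def IsStationarySolution {N : ℕ} (Ω : Set (EuclideanSpace ℝ (Fin N))) (s p : ℝ)
    (u : EuclideanSpace ℝ (Fin N) → ℝ) : Prop :=
  u ∈ W0 Ω s p ∧ ∀ v ∈ W0 Ω s p,
    formK N s p u v + ∫ x in Ω, |u x| ^ (p - 2) * u x * v x
      = ∫ x in Ω, |u x| ^ (p - 2) * u x * Real.log |u x| * v x

/-- A ground state: a nontrivial weak solution of the stationary problem whose energy is least
among all nontrivial weak solutions. -/
def IsGroundState {N : ℕ} (Ω : Set (EuclideanSpace ℝ (Fin N))) (s p : ℝ)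
    (u : EuclideanSpace ℝ (Fin N) → ℝ) : Prop :=
  u ∈ X0 Ω s p ∧ IsStationarySolution Ω s p u ∧
    ∀ w ∈ X0 Ω s p, IsStationarySolution Ω s p w → energy Ω s p u ≤ energy Ω s p w

end FracLog

end

/-!
Scaling gives `I(l u) = l^p (I(u) - ‖u‖_p^p log l)`, so every ray through `u ≠ 0` meets the Nehari
manifold exactly once, at `l = exp (I(u) / ‖u‖_p^p)`, and the energy is largest there. This is the
minimax formula for `d`, and on the Nehari manifold the energy is `‖u‖_p^p / p²`.

Averaging `u` over a ball whose radius depends on the point bounds `|u(x)|^q`, for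
`q = p + s p² / N`, by the Gagliardo density of `u` at `x` and a power of `‖u‖_p`. Integrating gives
the embedding `∫ |u|^q ≤ c ‖u‖_p^(s p² / N) [u]^p` for all `N` and `s p`. As `|t|^p log |t|` grows
more slowly than `|t|^q`, this yields a logarithmic Sobolev inequality with an arbitrarily small
multiple of `[u]^p`; inserted into `I(u) = 0`, it bounds `‖u‖_p` below on the Nehari manifold.
Averaging over balls of a fixed small radius shows that `W_0^{s,p}(Ω)` embeds compactly into `L^p`.

A minimizing sequence on the Nehari manifold therefore converges in `L^p` to some `v ≠ 0`. Since the
seminorm is lower semicontinuous and the logarithmic term upper semicontinuous, `I(v) ≤ 0`, so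
projecting `v` along its ray shrinks it and produces a minimizer `u`. The maximum of the energy
along the ray through `u + t v` is then least at `t = 0`, and it has the same derivative there as
`E(u + t v)`.
-/

noncomputable section

namespace FracLog

open MeasureTheory Filter Topology

section Scalar

theorem abs_add_rpow_le (a b : ℝ) {p : ℝ} (hp : 1 ≤ p) :
    |a + b| ^ p ≤ 2 ^ (p - 1) * (|a| ^ p + |b| ^ p) :=
  calc |a + b| ^ p ≤ (|a| + |b|) ^ p := by gcongr; exact abs_add_le a b
    _ ≤ 2 ^ (p - 1) * (|a| ^ p + |b| ^ p) := by
      exact_mod_cast NNReal.rpow_add_le_mul_rpow_add_rpow ⟨|a|, abs_nonneg a⟩ ⟨|b|, abs_nonneg b⟩ hp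

theorem abs_rpow_sub_two_mul_self_mul_self (t : ℝ) {p : ℝ} (hp : p ≠ 0) :
    |t| ^ (p - 2) * t * t = |t| ^ p := by
  rcases eq_or_ne t 0 with rfl | ht
  · simp [Real.zero_rpow hp]
  · rw [mul_assoc, ← sq, ← sq_abs t, ← Real.rpow_natCast |t| 2, ← Real.rpow_add (abs_pos.2 ht)]
    norm_num

theorem abs_abs_rpow_sub_two_mul_self (t : ℝ) {p : ℝ} (hp : p ≠ 1) :
    |(|t| ^ (p - 2) * t)| = |t| ^ (p - 1) := by
  rcases eq_or_ne t 0 with rfl | ht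
  · simp [Real.zero_rpow (sub_ne_zero.2 hp)]
  · rw [abs_mul, abs_of_nonneg (by positivity), ← Real.rpow_add_one (abs_ne_zero.2 ht)]
    ring_nf

theorem rpow_mul_abs_log_le {r κ t : ℝ} (hr : 0 < r) (hκ : 0 < κ) (ht : 0 ≤ t) :
    t ^ r * |Real.log t| ≤ 1 / r + t ^ (r + κ) / κ := by
  rcases ht.eq_or_lt with rfl | ht₀
  · rw [Real.zero_rpow hr.ne', zero_mul]; positivity
  rcases le_total t 1 with ht₁ | ht₁
  · have h := (Real.abs_log_mul_self_rpow_lt t r ht₀ ht₁ hr).le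
    rw [abs_mul, mul_comm, abs_of_nonneg (by positivity : 0 ≤ t ^ r)] at h
    exact h.trans (le_add_of_nonneg_right (by positivity))
  · calc t ^ r * |Real.log t| ≤ t ^ r * (t ^ κ / κ) := by
          rw [abs_of_nonneg (Real.log_nonneg ht₁)]
          gcongr
          exact Real.log_le_rpow_div ht hκ
      _ = t ^ (r + κ) / κ := by rw [Real.rpow_add ht₀, mul_div_assoc]
      _ ≤ 1 / r + t ^ (r + κ) / κ := le_add_of_nonneg_left (by positivity)

theorem exists_abs_rpow_mul_log_le {p q η : ℝ} (hp : 0 < p) (hpq : p < q) (hη : 0 < η) :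
    ∃ A, 0 ≤ A ∧ ∀ t : ℝ, |t| ^ p * Real.log |t| ≤ η * |t| ^ q + A := by
  obtain ⟨T, hT⟩ := eventually_atTop.1
    ((isLittleO_log_rpow_atTop (sub_pos.2 hpq)).bound hη |>.and (eventually_ge_atTop 1))
  have hT₁ : 1 ≤ T := (hT T le_rfl).2
  have hA : 0 ≤ T ^ p * Real.log T :=
    mul_nonneg (by positivity) (Real.log_nonneg hT₁)
  refine ⟨T ^ p * Real.log T, hA, fun t => ?_⟩
  rcases le_total T |t| with ht | ht
  · have ht₀ : 0 < |t| := by linarith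
    have hlog : Real.log |t| ≤ η * |t| ^ (q - p) := by
      simpa [abs_of_nonneg (Real.rpow_nonneg (abs_nonneg t) (q - p))] using
        (le_abs_self _).trans (hT _ ht).1
    calc |t| ^ p * Real.log |t| ≤ |t| ^ p * (η * |t| ^ (q - p)) := by gcongr
      _ = η * |t| ^ q := by rw [mul_left_comm, ← Real.rpow_add ht₀, add_sub_cancel]
      _ ≤ η * |t| ^ q + T ^ p * Real.log T := le_add_of_nonneg_right hA
  · refine le_trans ?_ (le_add_of_nonneg_left (by positivity))
    rcases le_total |t| 1 with ht₁ | ht₁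
    · exact (mul_nonpos_of_nonneg_of_nonpos (by positivity)
        (Real.log_nonpos (abs_nonneg t) ht₁)).trans hA
    · have := Real.log_nonneg ht₁
      gcongr

theorem hasDerivAt_abs_rpow_mul_log (x : ℝ) {p : ℝ} (hp : 1 < p) :
    HasDerivAt (fun x => |x| ^ p * Real.log |x|)
      (p * (|x| ^ (p - 2) * x * Real.log |x|) + |x| ^ (p - 2) * x) x := by
  rcases eq_or_ne x 0 with rfl | hx
  · have hlim : Tendsto (fun y : ℝ => Real.log |y| * |y| ^ (p - 1)) (𝓝[≠] 0) (𝓝 0) :=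
      (tendsto_log_mul_rpow_nhdsGT_zero (sub_pos.2 hp)).comp tendsto_abs_nhdsNE_zero
    rw [hasDerivAt_iff_tendsto_slope]
    simp only [mul_zero, zero_mul, add_zero]
    refine squeeze_zero_norm' ?_ (by simpa only [norm_zero] using hlim.norm)
    filter_upwards [self_mem_nhdsWithin] with y hy
    have hy₀ : 0 < |y| := abs_pos.2 hy
    simp only [slope_def_field, abs_zero, Real.log_zero, mul_zero, sub_zero, Real.norm_eq_abs,
      abs_div, abs_mul, Real.rpow_sub_one hy₀.ne', abs_abs y]
    exact le_of_eq (by ring)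
  · have h := (hasDerivAt_abs_rpow x hp).mul (Real.hasDerivAt_log hx)
    simp only [Real.log_abs]
    refine h.congr_deriv ?_
    rw [← abs_rpow_sub_two_mul_self_mul_self x (by linarith : p ≠ 0)]
    field_simp

theorem continuous_abs_rpow_mul_log {p : ℝ} (hp : 1 < p) :
    Continuous fun x : ℝ => |x| ^ p * Real.log |x| :=
  continuous_iff_continuousAt.2 fun x => (hasDerivAt_abs_rpow_mul_log x hp).continuousAt

theorem abs_deriv_abs_rpow_mul_log_le {p q : ℝ} (hp : 1 < p) (hpq : p < q) (x : ℝ) :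
    |p * (|x| ^ (p - 2) * x * Real.log |x|) + |x| ^ (p - 2) * x| ≤
      (p / (p - 1) + 1) + (p / (q - p) + 1) * |x| ^ (q - 1) := by
  have hlog := rpow_mul_abs_log_le (sub_pos.2 hp) (sub_pos.2 hpq) (abs_nonneg x)
  have hone : |x| ^ (p - 1) ≤ 1 + |x| ^ (q - 1) := by
    rcases le_total |x| 1 with h | h
    · exact (Real.rpow_le_one (abs_nonneg x) h (by linarith)).trans
        (le_add_of_nonneg_right (by positivity))
    · exact (Real.rpow_le_rpow_of_exponent_le h (by linarith)).trans
        (le_add_of_nonneg_left zero_le_one)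
  rw [show p - 1 + (q - p) = q - 1 by ring] at hlog
  calc _ ≤ p * (|x| ^ (p - 1) * |Real.log (|x|)|) + |x| ^ (p - 1) := by
        refine (abs_add_le _ _).trans_eq ?_
        rw [abs_mul, abs_mul (_ * _), abs_abs_rpow_sub_two_mul_self x hp.ne',
          abs_of_pos (by linarith)]
    _ ≤ p * (1 / (p - 1) + |x| ^ (q - 1) / (q - p)) + (1 + |x| ^ (q - 1)) := by gcongr
    _ = _ := by ring

end Scalar

section Integral

variable {α : Type*} [MeasurableSpace α] {μ : Measure α}

theorem integrable_abs_rpow_of_memLp {f : α → ℝ} {p : ℝ} (hp : 0 < p)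
    (hf : MemLp f (ENNReal.ofReal p) μ) : Integrable (fun x => |f x| ^ p) μ := by
  simpa [ENNReal.toReal_ofReal hp.le] using
    hf.integrable_norm_rpow (by simpa using hp) ENNReal.ofReal_ne_top

theorem integrable_abs_rpow_mul_log [IsFiniteMeasure μ] {f : α → ℝ} {p q : ℝ} (hp : 0 < p)
    (hpq : p < q) (hf : MemLp f (ENNReal.ofReal q) μ) :
    Integrable (fun x => |f x| ^ p * Real.log |f x|) μ := by
  have habs := hf.1.aemeasurable.abs
  refine Integrable.mono' (g := fun x => 1 / p + |f x| ^ q / (q - p))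
    ((integrable_const _).add ((integrable_abs_rpow_of_memLp (hp.trans hpq) hf).div_const _))
    ((habs.pow_const p).mul (Real.measurable_log.comp_aemeasurable habs)).aestronglyMeasurable
    (.of_forall fun x => ?_)
  rw [Real.norm_eq_abs, abs_mul, abs_of_nonneg (by positivity : 0 ≤ |f x| ^ p)]
  simpa using rpow_mul_abs_log_le hp (sub_pos.2 hpq) (abs_nonneg (f x))

/-- The dominating function is `b (|f| + |h|) |h|`, valid for all `|t| < 1`. -/
theorem hasDerivAt_integral_comp_add_mul {Φ φ b : ℝ → ℝ} (hΦ : ∀ x, HasDerivAt Φ (φ x) x)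
    (hφ : ∀ x, |φ x| ≤ b |x|) (hb : MonotoneOn b (Set.Ici 0)) {f h : α → ℝ}
    (hf : AEMeasurable f μ) (hh : AEMeasurable h μ) (hΦf : Integrable (fun x => Φ (f x)) μ)
    (hbound : Integrable (fun x => b (|f x| + |h x|) * |h x|) μ) :
    Integrable (fun x => φ (f x) * h x) μ ∧
      HasDerivAt (fun t : ℝ => ∫ x, Φ (f x + t * h x) ∂μ) (∫ x, φ (f x) * h x ∂μ) 0 := by
  have hΦ_cont : Continuous Φ := continuous_iff_continuousAt.2 fun x => (hΦ x).continuousAt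
  have hφ_meas : Measurable φ := by
    rw [← funext fun x => (hΦ x).deriv]
    exact measurable_deriv Φ
  have hderiv := hasDerivAt_integral_of_dominated_loc_of_deriv_le (μ := μ)
    (F := fun t x => Φ (f x + t * h x)) (F' := fun t x => φ (f x + t * h x) * h x) (x₀ := (0 : ℝ))
    (Metric.ball_mem_nhds 0 one_pos)
    (.of_forall fun t => (hΦ_cont.measurable.comp_aemeasurable
      (hf.add (hh.const_mul t))).aestronglyMeasurable)
    (by simpa using hΦf)
    ((hφ_meas.comp_aemeasurable (hf.add (hh.const_mul 0))).mul hh).aestronglyMeasurable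
    (.of_forall fun x t ht => ?_) hbound
    (.of_forall fun x t _ => ?_)
  · simpa only [zero_mul, add_zero] using hderiv
  · have ht' : |t| ≤ 1 := by simpa using (Metric.mem_ball.1 ht).le
    have hle : |f x + t * h x| ≤ |f x| + |h x| :=
      (abs_add_le _ _).trans (by rw [abs_mul]; gcongr; exact mul_le_of_le_one_left (by simp) ht')
    rw [Real.norm_eq_abs, abs_mul]
    gcongr
    exact (hφ _).trans (hb (Set.mem_Ici.2 (abs_nonneg _)) (Set.mem_Ici.2 (by positivity)) hle)
  · exact (hΦ _).comp t (((hasDerivAt_mul_const (h x)).const_add (f x)))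

theorem integrable_add_rpow_sub_one_mul {f h : α → ℝ} {q : ℝ} (hq : 1 ≤ q)
    (hf : MemLp f (ENNReal.ofReal q) μ) (hh : MemLp h (ENNReal.ofReal q) μ) :
    Integrable (fun x => (|f x| + |h x|) ^ (q - 1) * |h x|) μ := by
  have hf' := hf.1.aemeasurable
  have hh' := hh.1.aemeasurable
  refine (integrable_abs_rpow_of_memLp (by linarith) (hf.norm.add hh.norm)).mono'
    (AEMeasurable.aestronglyMeasurable (by fun_prop)) (.of_forall fun x => ?_)
  have h0 : 0 ≤ |f x| + |h x| := by positivity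
  calc ‖(|f x| + |h x|) ^ (q - 1) * |h x|‖ = (|f x| + |h x|) ^ (q - 1) * |h x| := by
        rw [Real.norm_eq_abs, abs_of_nonneg (by positivity)]
    _ ≤ (|f x| + |h x|) ^ (q - 1) * (|f x| + |h x|) ^ (1 : ℝ) := by
        rw [Real.rpow_one]; gcongr; exact le_add_of_nonneg_left (abs_nonneg _)
    _ = |(|f x| + |h x|)| ^ q := by
        rw [← Real.rpow_add' h0 (by linarith), sub_add_cancel, abs_of_nonneg h0]

theorem hasDerivAt_integral_abs_rpow {f h : α → ℝ} {p : ℝ} (hp : 1 < p)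
    (hf : MemLp f (ENNReal.ofReal p) μ) (hh : MemLp h (ENNReal.ofReal p) μ) :
    Integrable (fun x => |f x| ^ (p - 2) * f x * h x) μ ∧
      HasDerivAt (fun t : ℝ => ∫ x, |f x + t * h x| ^ p ∂μ)
        (p * ∫ x, |f x| ^ (p - 2) * f x * h x ∂μ) 0 := by
  have hp₀ : 0 < p := by linarith
  obtain ⟨hint, hderiv⟩ := hasDerivAt_integral_comp_add_mul (μ := μ) (b := fun t => p * t ^ (p - 1))
    (fun x => hasDerivAt_abs_rpow x hp)
    (fun x => by rw [mul_assoc, abs_mul, abs_abs_rpow_sub_two_mul_self x hp.ne', abs_of_pos hp₀])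
    (fun x hx y _ hxy => by have : 0 ≤ x := hx; dsimp only; gcongr)
    hf.1.aemeasurable hh.1.aemeasurable (integrable_abs_rpow_of_memLp hp₀ hf)
    (by simpa only [mul_assoc] using (integrable_add_rpow_sub_one_mul hp.le hf hh).const_mul p)
  simp only [mul_assoc p, integral_const_mul] at hint hderiv
  exact ⟨by simpa [hp₀.ne'] using hint.const_mul p⁻¹, hderiv⟩

theorem hasDerivAt_integral_abs_rpow_mul_log [IsFiniteMeasure μ] {f h : α → ℝ} {p q : ℝ}
    (hp : 1 < p) (hpq : p < q) (hf : MemLp f (ENNReal.ofReal q) μ)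
    (hh : MemLp h (ENNReal.ofReal q) μ) :
    Integrable (fun x => |f x| ^ (p - 2) * f x * Real.log |f x| * h x) μ ∧
      HasDerivAt (fun t : ℝ => ∫ x, |f x + t * h x| ^ p * Real.log |f x + t * h x| ∂μ)
        (p * (∫ x, |f x| ^ (p - 2) * f x * Real.log |f x| * h x ∂μ)
          + ∫ x, |f x| ^ (p - 2) * f x * h x ∂μ) 0 := by
  have hp₀ : 0 < p := by linarith
  have hle : ENNReal.ofReal p ≤ ENNReal.ofReal q := ENNReal.ofReal_le_ofReal hpq.le
  have hpow := (hasDerivAt_integral_abs_rpow hp (hf.mono_exponent hle) (hh.mono_exponent hle)).1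
  have hh₁ : Integrable h μ :=
    hh.integrable (by simpa using (ENNReal.ofReal_le_ofReal (hp.trans hpq).le))
  obtain ⟨hint, hderiv⟩ := hasDerivAt_integral_comp_add_mul (μ := μ)
    (b := fun t => (p / (p - 1) + 1) + (p / (q - p) + 1) * t ^ (q - 1))
    (fun x => hasDerivAt_abs_rpow_mul_log x hp)
    (abs_deriv_abs_rpow_mul_log_le hp hpq)
    (fun x hx y _ hxy => by
      have : 0 ≤ x := hx
      have := sub_pos.2 hpq
      dsimp only; gcongr; linarith)
    hf.1.aemeasurable hh.1.aemeasurable (integrable_abs_rpow_mul_log hp₀ hpq hf)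
    (by
      simp only [add_mul _ (_ * _), mul_assoc]
      exact (hh₁.abs.const_mul _).add
        ((integrable_add_rpow_sub_one_mul (hp.trans hpq).le hf hh).const_mul _))
  have hlog : Integrable (fun x => |f x| ^ (p - 2) * f x * Real.log |f x| * h x) μ := by
    refine ((hint.sub hpow).const_mul p⁻¹).congr (.of_forall fun x => ?_)
    simp only [Pi.sub_apply]
    field_simp
    ring
  refine ⟨hlog, hderiv.congr_deriv ?_⟩
  rw [← integral_const_mul, ← integral_add (hlog.const_mul p) hpow]
  congr with x
  ring

theorem eventually_lt_integral_of_ae_tendsto {F : ℕ → α → ℝ} {G : α → ℝ}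
    (hF : ∀ n, Integrable (F n) μ) (hF₀ : ∀ n, 0 ≤ F n) (hG : Integrable G μ)
    (hlim : ∀ᵐ x ∂μ, Tendsto (fun n => F n x) atTop (𝓝 (G x))) {a : ℝ} (ha : a < ∫ x, G x ∂μ) :
    ∀ᶠ n in atTop, a < ∫ x, F n x ∂μ := by
  rcases lt_or_ge a 0 with ha₀ | ha₀
  · exact .of_forall fun n => ha₀.trans_le (integral_nonneg (hF₀ n))
  have hG₀ : 0 ≤ᵐ[μ] G := hlim.mono fun x hx => ge_of_tendsto' hx fun n => hF₀ n x
  have hfatou : ENNReal.ofReal a < liminf (fun n => ∫⁻ x, ENNReal.ofReal (F n x) ∂μ) atTop :=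
    calc ENNReal.ofReal a < ENNReal.ofReal (∫ x, G x ∂μ) :=
          (ENNReal.ofReal_lt_ofReal_iff (ha₀.trans_lt ha)).2 ha
      _ = ∫⁻ x, ENNReal.ofReal (G x) ∂μ := ofReal_integral_eq_lintegral_ofReal hG hG₀
      _ = ∫⁻ x, liminf (fun n => ENNReal.ofReal (F n x)) atTop ∂μ :=
          lintegral_congr_ae (hlim.mono fun x hx => (ENNReal.tendsto_ofReal hx).liminf_eq.symm)
      _ ≤ _ := lintegral_liminf_le' fun n => (hF n).aemeasurable.ennreal_ofReal
  filter_upwards [eventually_lt_of_lt_liminf hfatou] with n hn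
  rw [← ofReal_integral_eq_lintegral_ofReal (hF n) (.of_forall (hF₀ n))] at hn
  exact (ENNReal.ofReal_lt_ofReal_iff_of_nonneg ha₀).1 hn

/-- Fatou's lemma applied to `η |f n|^q + A - g (f n) ≥ 0`, with `η` small. -/
theorem eventually_integral_comp_lt_of_ae_tendsto [IsFiniteMeasure μ] {g : ℝ → ℝ}
    (hg : Continuous g) {q Q : ℝ} (hq : 0 < q)
    (hgrowth : ∀ η > 0, ∃ A, ∀ t, g t ≤ η * |t| ^ q + A) {f : ℕ → α → ℝ} {w : α → ℝ}
    (hf : ∀ n, MemLp (f n) (ENNReal.ofReal q) μ) (hw : MemLp w (ENNReal.ofReal q) μ)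
    (hgf : ∀ n, Integrable (fun x => g (f n x)) μ) (hgw : Integrable (fun x => g (w x)) μ)
    (hbdd : ∀ n, ∫ x, |f n x| ^ q ∂μ ≤ Q)
    (hlim : ∀ᵐ x ∂μ, Tendsto (fun n => f n x) atTop (𝓝 (w x))) {a : ℝ}
    (ha : ∫ x, g (w x) ∂μ < a) :
    ∀ᶠ n in atTop, ∫ x, g (f n x) ∂μ < a := by
  have hQ : 0 ≤ Q := (integral_nonneg fun x => by positivity).trans (hbdd 0)
  obtain ⟨η, hη, hηQ⟩ : ∃ η > 0, η * Q < a - ∫ x, g (w x) ∂μ :=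
    ⟨(a - ∫ x, g (w x) ∂μ) / (Q + 1), div_pos (sub_pos.2 ha) (by linarith), by
      rw [div_mul_eq_mul_div, div_lt_iff₀ (by linarith)]
      nlinarith⟩
  obtain ⟨A, hA⟩ := hgrowth η hη
  have hgap {v : α → ℝ} (hv : MemLp v (ENNReal.ofReal q) μ)
      (hgv : Integrable (fun x => g (v x)) μ) :
      Integrable (fun x => η * |v x| ^ q + A - g (v x)) μ ∧
        ∫ x, η * |v x| ^ q + A - g (v x) ∂μ
          = η * (∫ x, |v x| ^ q ∂μ) + (∫ _, A ∂μ) - ∫ x, g (v x) ∂μ := by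
    have hpow := (integrable_abs_rpow_of_memLp hq hv).const_mul η
    have hsum : Integrable (fun x => η * |v x| ^ q + A) μ := hpow.add (integrable_const A)
    refine ⟨hsum.sub hgv, ?_⟩
    rw [integral_sub hsum hgv, integral_add hpow (integrable_const A), integral_const_mul]
  have hfatou := eventually_lt_integral_of_ae_tendsto (fun n => (hgap (hf n) (hgf n)).1)
    (fun n x => sub_nonneg.2 (hA _)) (hgap hw hgw).1
    (hlim.mono fun x hx => (((hx.abs.rpow_const (Or.inr hq.le)).const_mul η).add_const A).sub
      ((hg.tendsto _).comp hx)) (a := η * Q + (∫ _, A ∂μ) - a)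
    (by
      have : 0 ≤ ∫ x, |w x| ^ q ∂μ := integral_nonneg fun x => by positivity
      rw [(hgap hw hgw).2]
      nlinarith)
  filter_upwards [hfatou] with n hn
  rw [(hgap (hf n) (hgf n)).2] at hn
  nlinarith [hbdd n]

end Integral

section Space

variable {N : ℕ} {s p : ℝ} {Ω : Set (EuclideanSpace ℝ (Fin N))}
  {u v : EuclideanSpace ℝ (Fin N) → ℝ}

/-- The fractional difference quotient `(u x - u y) / |x - y|^(N/p + s)` as a function on
`ℝ^N × ℝ^N`: it is linear in `u`, and its `L^p` norm is the Gagliardo seminorm of `u`. -/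
def diffQuot (s p : ℝ) (u : EuclideanSpace ℝ (Fin N) → ℝ)
    (z : EuclideanSpace ℝ (Fin N) × EuclideanSpace ℝ (Fin N)) : ℝ :=
  (u z.1 - u z.2) / ‖z.1 - z.2‖ ^ (((N : ℝ) + s * p) / p)

theorem diffQuot_add : diffQuot s p (u + v) = diffQuot s p u + diffQuot s p v := by
  ext z
  simp only [diffQuot, Pi.add_apply]
  ring

theorem diffQuot_smul (t : ℝ) : diffQuot s p (t • u) = t • diffQuot s p u := by
  ext z
  simp only [diffQuot, Pi.smul_apply, smul_eq_mul]
  ring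

theorem abs_diffQuot_rpow (hp : p ≠ 0) (x y : EuclideanSpace ℝ (Fin N)) :
    |diffQuot s p u (x, y)| ^ p = |u x - u y| ^ p / ‖x - y‖ ^ ((N : ℝ) + s * p) := by
  rw [diffQuot, abs_div, Real.div_rpow (abs_nonneg _) (abs_nonneg _),
    abs_of_nonneg (by positivity : 0 ≤ ‖x - y‖ ^ (((N : ℝ) + s * p) / p)),
    ← Real.rpow_mul (norm_nonneg _), div_mul_cancel₀ _ hp]

theorem aemeasurable_diffQuot (hu : AEMeasurable u) : AEMeasurable (diffQuot s p u) := by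
  have hu₁ : AEMeasurable (fun z : EuclideanSpace ℝ (Fin N) × EuclideanSpace ℝ (Fin N) => u z.1) :=
    hu.aestronglyMeasurable.comp_fst.aemeasurable
  have hu₂ : AEMeasurable (fun z : EuclideanSpace ℝ (Fin N) × EuclideanSpace ℝ (Fin N) => u z.2) :=
    hu.aestronglyMeasurable.comp_snd.aemeasurable
  exact (hu₁.sub hu₂).div (by fun_prop)

theorem gagliardoPow_eq_lintegral_diffQuot (hp : p ≠ 0) (hu : AEMeasurable u) :
    gagliardoPow N s p u = ∫⁻ z, ENNReal.ofReal (|diffQuot s p u z| ^ p) := by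
  rw [Measure.volume_eq_prod, lintegral_prod]
  · simp only [abs_diffQuot_rpow hp, gagliardoPow]
  · exact ((aemeasurable_diffQuot hu).abs.pow_const p).ennreal_ofReal

theorem memLp_diffQuot_iff (hp : 0 < p) (hu : AEMeasurable u) :
    MemLp (diffQuot s p u) (ENNReal.ofReal p) ↔ gagliardoPow N s p u < ⊤ := by
  rw [MemLp, and_iff_right (aemeasurable_diffQuot hu).aestronglyMeasurable,
    eLpNorm_lt_top_iff_lintegral_rpow_enorm_lt_top (by simpa using hp) ENNReal.ofReal_ne_top,
    gagliardoPow_eq_lintegral_diffQuot hp.ne' hu, ENNReal.toReal_ofReal hp.le]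
  simp only [Real.enorm_eq_ofReal_abs, ENNReal.ofReal_rpow_of_nonneg (abs_nonneg _) hp.le]

theorem toReal_gagliardoPow (hp : p ≠ 0) (hu : AEMeasurable u) :
    (gagliardoPow N s p u).toReal = ∫ z, |diffQuot s p u z| ^ p := by
  rw [gagliardoPow_eq_lintegral_diffQuot hp hu, integral_eq_lintegral_of_nonneg_ae
    (.of_forall fun z => by positivity)
    ((aemeasurable_diffQuot hu).abs.pow_const p).aestronglyMeasurable]

theorem memLp_diffQuot (hp : 0 < p) (hu : u ∈ W0 Ω s p) :
    MemLp (diffQuot s p u) (ENNReal.ofReal p) :=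
  (memLp_diffQuot_iff hp hu.1.1.aemeasurable).2 hu.2.1

theorem mem_W0_of_memLp_diffQuot (hp : 0 < p) (hu : MemLp u (ENNReal.ofReal p))
    (hd : MemLp (diffQuot s p u) (ENNReal.ofReal p)) (h0 : ∀ᵐ x, x ∉ Ω → u x = 0) :
    u ∈ W0 Ω s p :=
  ⟨hu, (memLp_diffQuot_iff hp hu.1.aemeasurable).1 hd, h0⟩

/-- The set `W0` as a linear subspace of the space of all functions. -/
def W0Submodule (Ω : Set (EuclideanSpace ℝ (Fin N))) (s : ℝ) (hp : 0 < p) :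
    Submodule ℝ (EuclideanSpace ℝ (Fin N) → ℝ) where
  carrier := W0 Ω s p
  add_mem' {u v} hu hv := by
    refine mem_W0_of_memLp_diffQuot hp (hu.1.add hv.1) ?_ ?_
    · exact diffQuot_add ▸ (memLp_diffQuot hp hu).add (memLp_diffQuot hp hv)
    · filter_upwards [hu.2.2, hv.2.2] with x hux hvx hx
      simp [hux hx, hvx hx]
  zero_mem' := ⟨.zero, by simp [gagliardoPow, Real.zero_rpow hp.ne'], by simp⟩
  smul_mem' t u hu := by
    refine mem_W0_of_memLp_diffQuot hp (hu.1.const_smul t) ?_ ?_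
    · exact diffQuot_smul t ▸ (memLp_diffQuot hp hu).const_smul t
    · filter_upwards [hu.2.2] with x hux hx
      simp [hux hx]

theorem sub_mem_W0 (hp : 0 < p) (hu : u ∈ W0 Ω s p) (hv : v ∈ W0 Ω s p) : u - v ∈ W0 Ω s p :=
  (W0Submodule Ω s hp).sub_mem hu hv

theorem add_smul_mem_W0 (hp : 0 < p) (hu : u ∈ W0 Ω s p) (hv : v ∈ W0 Ω s p) (t : ℝ) :
    u + t • v ∈ W0 Ω s p :=
  (W0Submodule Ω s hp).add_mem hu ((W0Submodule Ω s hp).smul_mem t hv)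

theorem toReal_gagliardoPow_smul (l : ℝ) :
    (gagliardoPow N s p (l • u)).toReal = |l| ^ p * (gagliardoPow N s p u).toReal := by
  have hl : 0 ≤ |l| ^ p := by positivity
  simp only [gagliardoPow, Pi.smul_apply, smul_eq_mul, ← mul_sub, abs_mul,
    Real.mul_rpow (abs_nonneg _) (abs_nonneg _), mul_div_assoc, ENNReal.ofReal_mul hl,
    lintegral_const_mul' _ _ ENNReal.ofReal_ne_top]
  rw [ENNReal.toReal_mul, ENNReal.toReal_ofReal hl]

theorem toReal_gagliardoPow_sub_le (hp : 1 ≤ p) (hu : u ∈ W0 Ω s p) (hv : v ∈ W0 Ω s p) :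
    (gagliardoPow N s p (u - v)).toReal ≤
      2 ^ (p - 1) * ((gagliardoPow N s p u).toReal + (gagliardoPow N s p v).toReal) := by
  have hp₀ : 0 < p := by linarith
  have hint {w} (hw : w ∈ W0 Ω s p) : Integrable (fun z => |diffQuot s p w z| ^ p) :=
    integrable_abs_rpow_of_memLp hp₀ (memLp_diffQuot hp₀ hw)
  have huv := sub_mem_W0 hp₀ hu hv
  rw [toReal_gagliardoPow hp₀.ne' hu.1.1.aemeasurable,
    toReal_gagliardoPow hp₀.ne' hv.1.1.aemeasurable,
    toReal_gagliardoPow hp₀.ne' huv.1.1.aemeasurable, ← integral_add (hint hu) (hint hv),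
    ← integral_const_mul]
  refine integral_mono (hint huv) (((hint hu).add (hint hv)).const_mul _) fun z => ?_
  have h := abs_add_rpow_le (diffQuot s p u z) (-diffQuot s p v z) hp
  rwa [abs_neg, ← sub_eq_add_neg, show diffQuot s p u z - diffQuot s p v z
    = diffQuot s p (u - v) z by simp only [diffQuot, Pi.sub_apply]; ring] at h

theorem normPow_smul (l : ℝ) : normPow Ω p (l • u) = |l| ^ p * normPow Ω p u := by
  simp only [normPow, Pi.smul_apply, smul_eq_mul, abs_mul,
    Real.mul_rpow (abs_nonneg _) (abs_nonneg _), integral_const_mul]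

theorem normPow_nonneg : 0 ≤ normPow Ω p u :=
  integral_nonneg fun _ => by positivity

theorem normPow_eq_integral (hp : p ≠ 0) (hu : u ∈ W0 Ω s p) : normPow Ω p u = ∫ x, |u x| ^ p :=
  setIntegral_eq_integral_of_ae_compl_eq_zero <| hu.2.2.mono fun x hx hxΩ => by
    simp [hx hxΩ, Real.zero_rpow hp]

theorem normPow_pos_iff (hp : 0 < p) (hu : u ∈ W0 Ω s p) :
    0 < normPow Ω p u ↔ ¬ ∀ᵐ x, u x = 0 := by
  rw [normPow_eq_integral hp.ne' hu, (integral_nonneg fun x => by positivity).lt_iff_ne', ne_eq,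
    integral_eq_zero_iff_of_nonneg (fun x => by positivity) (integrable_abs_rpow_of_memLp hp hu.1)]
  refine not_congr (eventually_congr (.of_forall fun x => ?_))
  simp [Real.rpow_eq_zero (abs_nonneg (u x)) hp.ne']

theorem mem_X0_iff_normPow_pos (hp : 0 < p) (hu : u ∈ W0 Ω s p) :
    u ∈ X0 Ω s p ↔ 0 < normPow Ω p u := by
  rw [normPow_pos_iff hp hu]
  exact and_iff_right hu

theorem normPow_pos (hp : 0 < p) (hu : u ∈ X0 Ω s p) : 0 < normPow Ω p u :=
  (mem_X0_iff_normPow_pos hp hu.1).1 hu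

theorem smul_mem_X0 (hp : 0 < p) (hu : u ∈ X0 Ω s p) {l : ℝ} (hl : 0 < l) : l • u ∈ X0 Ω s p := by
  have hm := normPow_pos hp hu
  rw [mem_X0_iff_normPow_pos hp ((W0Submodule Ω s hp).smul_mem l hu.1), normPow_smul]
  positivity

theorem abs_diffQuot_rpow_sub_two_mul_mul (hp : p ≠ 0) (x y : EuclideanSpace ℝ (Fin N)) :
    |diffQuot s p u (x, y)| ^ (p - 2) * diffQuot s p u (x, y) * diffQuot s p v (x, y) =
      |u x - u y| ^ (p - 2) * (u x - u y) / ‖x - y‖ ^ ((N : ℝ) + s * p) * (v x - v y) := by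
  rcases eq_or_ne x y with rfl | hxy
  · simp [diffQuot]
  set k := ‖x - y‖ ^ (((N : ℝ) + s * p) / p) with hk
  have hk₀ : 0 < k := Real.rpow_pos_of_pos (norm_pos_iff.2 (sub_ne_zero.2 hxy)) _
  have hkp : ‖x - y‖ ^ ((N : ℝ) + s * p) = k ^ p := by
    rw [hk, ← Real.rpow_mul (norm_nonneg _), div_mul_cancel₀ _ hp]
  have hkp' : k ^ (p - 2) * k * k = k ^ p := by
    simpa [abs_of_pos hk₀] using abs_rpow_sub_two_mul_self_mul_self k hp
  rw [hkp, ← hkp', diffQuot, diffQuot, ← hk, abs_div, abs_of_pos hk₀,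
    Real.div_rpow (abs_nonneg _) hk₀.le]
  field_simp

theorem hasDerivAt_gagliardoPow (hp : 1 < p) (hu : u ∈ W0 Ω s p) (hv : v ∈ W0 Ω s p) :
    HasDerivAt (fun t : ℝ => (gagliardoPow N s p (u + t • v)).toReal) (p * formK N s p u v) 0 := by
  have hp₀ : 0 < p := by linarith
  obtain ⟨hint, hderiv⟩ := hasDerivAt_integral_abs_rpow hp (memLp_diffQuot hp₀ hu)
    (memLp_diffQuot hp₀ hv)
  rw [Measure.volume_eq_prod] at hint
  have hform : ∫ z, |diffQuot s p u z| ^ (p - 2) * diffQuot s p u z * diffQuot s p v z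
      = formK N s p u v := by
    rw [Measure.volume_eq_prod, integral_prod _ hint]
    simp only [abs_diffQuot_rpow_sub_two_mul_mul hp₀.ne', formK]
  rw [hform] at hderiv
  refine hderiv.congr_of_eventuallyEq (.of_forall fun t => ?_)
  dsimp only
  rw [toReal_gagliardoPow hp₀.ne' (add_smul_mem_W0 hp₀ hu hv t).1.1.aemeasurable, diffQuot_add,
    diffQuot_smul]
  simp only [Pi.add_apply, Pi.smul_apply, smul_eq_mul]

theorem hasDerivAt_normPow (hp : 1 < p) (hu : u ∈ W0 Ω s p) (hv : v ∈ W0 Ω s p) :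
    HasDerivAt (fun t : ℝ => normPow Ω p (u + t • v))
      (p * ∫ x in Ω, |u x| ^ (p - 2) * u x * v x) 0 :=
  (hasDerivAt_integral_abs_rpow hp (hu.1.restrict Ω) (hv.1.restrict Ω)).2

theorem ae_tendsto_diffQuot {f : ℕ → EuclideanSpace ℝ (Fin N) → ℝ}
    (hlim : ∀ᵐ x, Tendsto (fun n => f n x) atTop (𝓝 (u x))) :
    ∀ᵐ z, Tendsto (fun n => diffQuot s p (f n) z) atTop (𝓝 (diffQuot s p u z)) := by
  filter_upwards [Measure.quasiMeasurePreserving_fst.ae hlim,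
    Measure.quasiMeasurePreserving_snd.ae hlim] with z hz₁ hz₂
  exact (hz₁.sub hz₂).div_const _

theorem eventually_lt_toReal_gagliardoPow (hp : 0 < p) {f : ℕ → EuclideanSpace ℝ (Fin N) → ℝ}
    (hf : ∀ n, f n ∈ W0 Ω s p) (hu : u ∈ W0 Ω s p)
    (hlim : ∀ᵐ x, Tendsto (fun n => f n x) atTop (𝓝 (u x))) {a : ℝ}
    (ha : a < (gagliardoPow N s p u).toReal) :
    ∀ᶠ n in atTop, a < (gagliardoPow N s p (f n)).toReal := by
  rw [toReal_gagliardoPow hp.ne' hu.1.1.aemeasurable] at ha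
  refine (eventually_congr (.of_forall fun n => ?_)).1 <| eventually_lt_integral_of_ae_tendsto
    (fun n => integrable_abs_rpow_of_memLp hp (memLp_diffQuot hp (hf n)))
    (fun n z => by positivity) (integrable_abs_rpow_of_memLp hp (memLp_diffQuot hp hu))
    ((ae_tendsto_diffQuot hlim).mono fun z hz => hz.abs.rpow_const (Or.inr hp.le)) ha
  rw [toReal_gagliardoPow hp.ne' (hf n).1.1.aemeasurable]

/-- The bound on the Gagliardo seminorms passes to the limit by Fatou's lemma. -/
theorem mem_W0_of_ae_tendsto (hp : 0 < p) {f : ℕ → EuclideanSpace ℝ (Fin N) → ℝ} {K : ℝ}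
    (hf : ∀ n, f n ∈ W0 Ω s p) (hK : ∀ n, (gagliardoPow N s p (f n)).toReal ≤ K)
    (hu : MemLp u (ENNReal.ofReal p)) (hlim : ∀ᵐ x, Tendsto (fun n => f n x) atTop (𝓝 (u x))) :
    u ∈ W0 Ω s p := by
  refine ⟨hu, ?_, ?_⟩
  · rw [gagliardoPow_eq_lintegral_diffQuot hp.ne' hu.1.aemeasurable]
    calc ∫⁻ z, ENNReal.ofReal (|diffQuot s p u z| ^ p)
        = ∫⁻ z, liminf (fun n => ENNReal.ofReal (|diffQuot s p (f n) z| ^ p)) atTop :=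
          lintegral_congr_ae <| (ae_tendsto_diffQuot hlim).mono fun z hz =>
            (ENNReal.tendsto_ofReal (hz.abs.rpow_const (Or.inr hp.le))).liminf_eq.symm
      _ ≤ liminf (fun n => ∫⁻ z, ENNReal.ofReal (|diffQuot s p (f n) z| ^ p)) atTop :=
          lintegral_liminf_le' fun n => ((aemeasurable_diffQuot
            (hf n).1.1.aemeasurable).abs.pow_const p).ennreal_ofReal
      _ ≤ ENNReal.ofReal K := by
          refine liminf_le_of_le (by isBoundedDefault) fun b hb => ?_
          obtain ⟨n, hn⟩ := hb.exists
          rw [← gagliardoPow_eq_lintegral_diffQuot hp.ne' (hf n).1.1.aemeasurable] at hn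
          exact hn.trans (ENNReal.le_ofReal_iff_toReal_le (hf n).2.1.ne
            (ENNReal.toReal_nonneg.trans (hK 0)) |>.2 (hK n))
      _ < ⊤ := ENNReal.ofReal_lt_top
  · filter_upwards [hlim, ae_all_iff.2 fun n => (hf n).2.2] with x hx hzero hxΩ
    simp only [hzero _ hxΩ] at hx
    exact tendsto_nhds_unique hx tendsto_const_nhds

end Space

section Average

variable {p : ℝ}

theorem convexOn_abs_rpow (hp : 1 ≤ p) : ConvexOn ℝ Set.univ fun x : ℝ => |x| ^ p := by
  refine ⟨convex_univ, fun x _ y _ a b ha hb hab => ?_⟩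
  calc |a * x + b * y| ^ p ≤ (a * |x| + b * |y|) ^ p := by
        refine Real.rpow_le_rpow (abs_nonneg _) ((abs_add_le _ _).trans_eq ?_) (by linarith)
        rw [abs_mul, abs_mul, abs_of_nonneg ha, abs_of_nonneg hb]
    _ ≤ a * |x| ^ p + b * |y| ^ p :=
        (convexOn_rpow hp).2 (abs_nonneg x) (abs_nonneg y) ha hb hab

theorem abs_setAverage_rpow_le {α : Type*} [MeasurableSpace α] {μ : Measure α} {t : Set α}
    {f : α → ℝ} (hp : 1 ≤ p) (ht : μ t ≠ 0) (ht' : μ t ≠ ⊤)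
    (hf : MemLp f (ENNReal.ofReal p) (μ.restrict t)) :
    |⨍ y in t, f y ∂μ| ^ p ≤ ⨍ y in t, |f y| ^ p ∂μ := by
  have := isFiniteMeasure_restrict.2 ht'
  exact (convexOn_abs_rpow hp).map_set_average_le
    (continuous_abs.rpow_const fun _ => Or.inr (by linarith)).continuousOn isClosed_univ ht ht'
    (by simp) (hf.integrable (by simpa using hp))
    (integrable_abs_rpow_of_memLp (by linarith) hf)

end Average

section Poincare

variable {N : ℕ} {s p : ℝ}

/-- The inner integral of the Gagliardo seminorm, `∫ |u x - u y|^p / |x - y|^(N + s p) dy`. -/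
def gagliardoDensity (s p : ℝ) (u : EuclideanSpace ℝ (Fin N) → ℝ)
    (x : EuclideanSpace ℝ (Fin N)) : ENNReal :=
  ∫⁻ y, ENNReal.ofReal (|u x - u y| ^ p / ‖x - y‖ ^ ((N : ℝ) + s * p))

theorem aemeasurable_gagliardoDensity {u : EuclideanSpace ℝ (Fin N) → ℝ} (hu : AEMeasurable u) :
    AEMeasurable (gagliardoDensity s p u) := by
  refine AEMeasurable.lintegral_prod_right' (f := fun z : EuclideanSpace ℝ (Fin N) × _ =>
    ENNReal.ofReal (|u z.1 - u z.2| ^ p / ‖z.1 - z.2‖ ^ ((N : ℝ) + s * p))) ?_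
  have hu₁ : AEMeasurable (fun z : EuclideanSpace ℝ (Fin N) × EuclideanSpace ℝ (Fin N) => u z.1)
      (volume.prod volume) := hu.comp_quasiMeasurePreserving Measure.quasiMeasurePreserving_fst
  have hu₂ : AEMeasurable (fun z : EuclideanSpace ℝ (Fin N) × EuclideanSpace ℝ (Fin N) => u z.2)
      (volume.prod volume) := hu.comp_quasiMeasurePreserving Measure.quasiMeasurePreserving_snd
  exact (((hu₁.sub hu₂).norm.pow_const p).div (by fun_prop)).ennreal_ofReal

/-- The constant of the fractional Poincaré inequality on balls. -/
def poincareConst (N : ℕ) (s p : ℝ) : ℝ :=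
  2 ^ ((N : ℝ) + s * p) / volume.real (Metric.ball (0 : EuclideanSpace ℝ (Fin N)) 1)

theorem measureReal_unitBall_pos :
    0 < volume.real (Metric.ball (0 : EuclideanSpace ℝ (Fin N)) 1) :=
  ENNReal.toReal_pos (Metric.measure_ball_pos _ _ one_pos).ne' measure_ball_lt_top.ne

theorem measureReal_ball (c : EuclideanSpace ℝ (Fin N)) {r : ℝ} (hr : 0 < r) :
    volume.real (Metric.ball c r) =
      r ^ N * volume.real (Metric.ball (0 : EuclideanSpace ℝ (Fin N)) 1) := by
  rw [measureReal_def, Measure.addHaar_ball_of_pos volume c hr, finrank_euclideanSpace_fin,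
    ENNReal.toReal_mul, ENNReal.toReal_ofReal (by positivity), measureReal_def]

theorem poincareConst_pos : 0 < poincareConst N s p :=
  div_pos (by positivity) measureReal_unitBall_pos

theorem inv_measureReal_ball_mul_abs_sub_rpow_le (hp : 0 < p) (hs : 0 ≤ s)
    (u : EuclideanSpace ℝ (Fin N) → ℝ) {c x y : EuclideanSpace ℝ (Fin N)} {r : ℝ} (hr : 0 < r)
    (hx : x ∈ Metric.ball c r) (hy : y ∈ Metric.ball c r) :
    (volume.real (Metric.ball c r))⁻¹ * |u x - u y| ^ p ≤
      poincareConst N s p * r ^ (s * p) * (|u x - u y| ^ p / ‖x - y‖ ^ ((N : ℝ) + s * p)) := by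
  have hω : 0 < volume.real (Metric.ball (0 : EuclideanSpace ℝ (Fin N)) 1) :=
    measureReal_unitBall_pos
  rcases eq_or_ne x y with rfl | hxy
  · simp [Real.zero_rpow hp.ne']
  have hle : ‖x - y‖ ≤ 2 * r := by
    rw [← dist_eq_norm]
    have := dist_triangle_right x y c
    rw [Metric.mem_ball] at hx hy
    linarith
  have hpos : 0 < ‖x - y‖ := norm_pos_iff.2 (sub_ne_zero.2 hxy)
  have hscale : poincareConst N s p * r ^ (s * p) =
      (volume.real (Metric.ball c r))⁻¹ * (2 * r) ^ ((N : ℝ) + s * p) := by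
    rw [poincareConst, measureReal_ball c hr, Real.mul_rpow two_pos.le hr.le,
      Real.rpow_add hr, Real.rpow_natCast]
    field_simp
  rw [hscale, mul_assoc, mul_div_assoc', mul_comm (_ ^ _) (|_| ^ _), mul_div_assoc]
  refine mul_le_mul_of_nonneg_left (le_mul_of_one_le_right (by positivity) ?_) (by positivity)
  rw [one_le_div (by positivity)]
  gcongr

theorem setAverage_abs_sub_rpow_le (hp : 1 ≤ p) (hs : 0 ≤ s) {u : EuclideanSpace ℝ (Fin N) → ℝ}
    {c x : EuclideanSpace ℝ (Fin N)} {r : ℝ}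
    (hu : MemLp u (ENNReal.ofReal p) (volume.restrict (Metric.ball c r)))
    (hr : 0 < r) (hx : x ∈ Metric.ball c r) :
    ENNReal.ofReal (⨍ y in Metric.ball c r, |u x - u y| ^ p) ≤
      ENNReal.ofReal (poincareConst N s p * r ^ (s * p)) * gagliardoDensity s p u x := by
  have hp0 : 0 < p := by linarith
  have := isFiniteMeasure_restrict.2 (measure_ball_lt_top (μ := volume) (x := c) (r := r)).ne
  have hint : Integrable (fun y => |u x - u y| ^ p) (volume.restrict (Metric.ball c r)) :=
    integrable_abs_rpow_of_memLp hp0 ((memLp_const (u x)).sub hu)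
  rw [setAverage_eq, smul_eq_mul, ← integral_const_mul,
    ofReal_integral_eq_lintegral_ofReal (hint.const_mul _)
      (Eventually.of_forall fun y => by positivity),
    gagliardoDensity, ← lintegral_const_mul' _ _ ENNReal.ofReal_ne_top]
  refine (setLIntegral_mono' measurableSet_ball fun y hy => ?_).trans
    (setLIntegral_le_lintegral _ _)
  rw [← ENNReal.ofReal_mul (mul_nonneg poincareConst_pos.le (by positivity))]
  exact ENNReal.ofReal_le_ofReal
    (inv_measureReal_ball_mul_abs_sub_rpow_le hp0 hs u hr hx hy)

theorem abs_rpow_le_setAverage_add (hp : 1 ≤ p) (hs : 0 ≤ s) {u : EuclideanSpace ℝ (Fin N) → ℝ}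
    {c x : EuclideanSpace ℝ (Fin N)} {r : ℝ}
    (hu : MemLp u (ENNReal.ofReal p) (volume.restrict (Metric.ball c r)))
    (hr : 0 < r) (hx : x ∈ Metric.ball c r) :
    ENNReal.ofReal (|u x| ^ p) ≤ ENNReal.ofReal (2 ^ (p - 1)) *
      (ENNReal.ofReal (|⨍ y in Metric.ball c r, u y| ^ p) +
        ENNReal.ofReal (poincareConst N s p * r ^ (s * p)) * gagliardoDensity s p u x) := by
  have hball := (measure_ball_lt_top (μ := volume) (x := c) (r := r)).ne
  have hball0 := (Metric.measure_ball_pos volume c hr).ne'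
  have := isFiniteMeasure_restrict.2 hball
  set a := ⨍ y in Metric.ball c r, u y
  have hav : ⨍ y in Metric.ball c r, (u x - u y) = u x - a := by
    rw [setAverage_eq, integral_sub (integrable_const _) (hu.integrable (by simpa using hp)),
      smul_sub, ← setAverage_eq, ← setAverage_eq, setAverage_const hball0 hball]
  have hjensen : |u x - a| ^ p ≤ ⨍ y in Metric.ball c r, |u x - u y| ^ p :=
    hav ▸ abs_setAverage_rpow_le hp hball0 hball ((memLp_const (u x)).sub hu)
  calc ENNReal.ofReal (|u x| ^ p)
      ≤ ENNReal.ofReal (2 ^ (p - 1) * (|a| ^ p + |u x - a| ^ p)) := by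
        refine ENNReal.ofReal_le_ofReal ?_
        simpa only [add_sub_cancel] using abs_add_rpow_le a (u x - a) hp
    _ = ENNReal.ofReal (2 ^ (p - 1)) *
          (ENNReal.ofReal (|a| ^ p) + ENNReal.ofReal (|u x - a| ^ p)) := by
        rw [ENNReal.ofReal_mul (by positivity), ENNReal.ofReal_add (by positivity) (by positivity)]
    _ ≤ _ := by
        gcongr
        exact (ENNReal.ofReal_le_ofReal hjensen).trans (setAverage_abs_sub_rpow_le hp hs hu hr hx)

theorem abs_setAverage_ball_rpow_le (hp : 1 ≤ p) {u : EuclideanSpace ℝ (Fin N) → ℝ}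
    (hu : MemLp u (ENNReal.ofReal p)) (c : EuclideanSpace ℝ (Fin N)) {r : ℝ} (hr : 0 < r) :
    |⨍ y in Metric.ball c r, u y| ^ p ≤
      (volume.real (Metric.ball c r))⁻¹ * ∫ y, |u y| ^ p := by
  refine (abs_setAverage_rpow_le hp (Metric.measure_ball_pos volume c hr).ne'
    measure_ball_lt_top.ne (hu.restrict _)).trans ?_
  rw [setAverage_eq, smul_eq_mul]
  exact mul_le_mul_of_nonneg_left (setIntegral_le_integral
    (integrable_abs_rpow_of_memLp (by linarith) hu)
    (Eventually.of_forall fun _ => by positivity)) (by positivity)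

end Poincare

section GagliardoNirenberg

variable {N : ℕ} {s p : ℝ} {Ω : Set (EuclideanSpace ℝ (Fin N))}

/-- The exponent `p + s p² / N` of the Gagliardo-Nirenberg inequality below. It exceeds `p`, and the
inequality holds in the subcritical, critical and supercritical range alike. -/
def embeddingExponent (N : ℕ) (s p : ℝ) : ℝ := p + s * p / N * p

theorem lt_embeddingExponent [NeZero N] (hs : 0 < s) (hp : 0 < p) :
    p < embeddingExponent N s p := by
  have : (0 : ℝ) < N := Nat.cast_pos.2 (NeZero.pos N)
  rw [embeddingExponent, lt_add_iff_pos_right]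
  positivity

/-- The constant of the Gagliardo-Nirenberg inequality below. -/
def embeddingConst (N : ℕ) (s p : ℝ) : ℝ :=
  2 ^ p * poincareConst N s p *
    (2 ^ p / volume.real (Metric.ball (0 : EuclideanSpace ℝ (Fin N)) 1)) ^ (s * p / N)

theorem embeddingConst_pos : 0 < embeddingConst N s p :=
  mul_pos (mul_pos (by positivity) poincareConst_pos)
    (Real.rpow_pos_of_pos (div_pos (by positivity) measureReal_unitBall_pos) _)

theorem abs_rpow_le_of_measureReal_ball_eq (hp : 1 ≤ p) (hs : 0 ≤ s)
    {u : EuclideanSpace ℝ (Fin N) → ℝ} (hu : MemLp u (ENNReal.ofReal p))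
    {x : EuclideanSpace ℝ (Fin N)} {r : ℝ} (hr : 0 < r)
    (hball : volume.real (Metric.ball x r) * |u x| ^ p = 2 ^ p * ∫ y, |u y| ^ p) :
    ENNReal.ofReal (|u x| ^ p) ≤
      ENNReal.ofReal (2 ^ p * poincareConst N s p * r ^ (s * p)) * gagliardoDensity s p u x := by
  have hV : 0 < volume.real (Metric.ball x r) :=
    ENNReal.toReal_pos (Metric.measure_ball_pos _ _ hr).ne' measure_ball_lt_top.ne
  have hhalf : 2 ^ (p - 1) * |⨍ y in Metric.ball x r, u y| ^ p ≤ |u x| ^ p / 2 := by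
    calc 2 ^ (p - 1) * |⨍ y in Metric.ball x r, u y| ^ p
        ≤ 2 ^ (p - 1) * ((volume.real (Metric.ball x r))⁻¹ * ∫ y, |u y| ^ p) := by
          gcongr
          exact abs_setAverage_ball_rpow_le hp hu x hr
      _ = |u x| ^ p / 2 := by
          rw [Real.rpow_sub_one two_ne_zero]
          field_simp
          linarith
  have hpoincare := abs_rpow_le_setAverage_add hp hs (hu.restrict (Metric.ball x r)) hr
    (Metric.mem_ball_self hr)
  rw [mul_add, ← ENNReal.ofReal_mul (by positivity)] at hpoincare
  have : 0 ≤ poincareConst N s p := poincareConst_pos.le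
  have habsorb : ENNReal.ofReal (|u x| ^ p / 2) ≤ ENNReal.ofReal (2 ^ (p - 1)) *
      (ENNReal.ofReal (poincareConst N s p * r ^ (s * p)) * gagliardoDensity s p u x) := by
    refine (ENNReal.add_le_add_iff_left (a := ENNReal.ofReal (|u x| ^ p / 2))
      ENNReal.ofReal_ne_top).1 ?_
    rw [← ENNReal.ofReal_add (by positivity) (by positivity), add_halves]
    exact hpoincare.trans (by gcongr)
  calc ENNReal.ofReal (|u x| ^ p) = ENNReal.ofReal 2 * ENNReal.ofReal (|u x| ^ p / 2) := by
        rw [← ENNReal.ofReal_mul two_pos.le, mul_div_cancel₀ _ two_ne_zero]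
    _ ≤ ENNReal.ofReal 2 * (ENNReal.ofReal (2 ^ (p - 1)) *
          (ENNReal.ofReal (poincareConst N s p * r ^ (s * p)) * gagliardoDensity s p u x)) := by
        gcongr
    _ = _ := by
        rw [← mul_assoc, ← mul_assoc, ← ENNReal.ofReal_mul two_pos.le,
          ← ENNReal.ofReal_mul (by positivity), ← Real.rpow_one_add' two_pos.le (by linarith),
          add_sub_cancel, mul_assoc]

/-- The Poincaré inequality on the ball around `x` whose radius is so large that the average of `u`
is at most half of `u x`. -/
theorem abs_rpow_embeddingExponent_le [NeZero N] (hp : 1 ≤ p) (hs : 0 < s)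
    {u : EuclideanSpace ℝ (Fin N) → ℝ} (hu : MemLp u (ENNReal.ofReal p))
    (hu0 : 0 < ∫ y, |u y| ^ p) (x : EuclideanSpace ℝ (Fin N)) :
    ENNReal.ofReal (|u x| ^ embeddingExponent N s p) ≤
      ENNReal.ofReal (embeddingConst N s p * (∫ y, |u y| ^ p) ^ (s * p / N)) *
        gagliardoDensity s p u x := by
  have hp0 : 0 < p := by linarith
  rcases eq_or_ne (u x) 0 with hx | hx
  · simp [hx, Real.zero_rpow (hp0.trans (lt_embeddingExponent hs hp0)).ne']
  have : (0 : ℝ) < N := Nat.cast_pos.2 (NeZero.pos N)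
  have hω : 0 < volume.real (Metric.ball (0 : EuclideanSpace ℝ (Fin N)) 1) :=
    measureReal_unitBall_pos
  have hK : 0 < poincareConst N s p := poincareConst_pos
  have hux : 0 < |u x| := abs_pos.2 hx
  set m := ∫ y, |u y| ^ p
  set A := 2 ^ p / volume.real (Metric.ball (0 : EuclideanSpace ℝ (Fin N)) 1) with hA
  have hA0 : 0 < A := by positivity
  set R := A * m / |u x| ^ p with hR
  have hR0 : 0 < R := by positivity
  have hball : volume.real (Metric.ball x (R ^ (N : ℝ)⁻¹)) * |u x| ^ p = 2 ^ p * m := by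
    rw [measureReal_ball x (by positivity), Real.rpow_inv_natCast_pow hR0.le (NeZero.ne N), hR, hA]
    field_simp
  have hpow : |u x| ^ embeddingExponent N s p = (|u x| ^ p) ^ (s * p / N) * |u x| ^ p := by
    rw [embeddingExponent, add_comm, Real.rpow_add hux, mul_comm _ p, Real.rpow_mul hux.le]
  have hconst : embeddingConst N s p * m ^ (s * p / N) = (|u x| ^ p) ^ (s * p / N) *
      (2 ^ p * poincareConst N s p * (R ^ (N : ℝ)⁻¹) ^ (s * p)) := by
    rw [embeddingConst, ← hA, ← Real.rpow_mul hR0.le, inv_mul_eq_div, hR,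
      Real.div_rpow (mul_pos hA0 hu0).le (by positivity), Real.mul_rpow hA0.le hu0.le]
    field_simp
  rw [hpow, hconst, ENNReal.ofReal_mul (by positivity), ENNReal.ofReal_mul (by positivity),
    mul_assoc]
  gcongr
  exact abs_rpow_le_of_measureReal_ball_eq hp hs.le hu (by positivity) hball

theorem lintegral_abs_rpow_embeddingExponent_le [NeZero N] (hp : 1 ≤ p) (hs : 0 < s)
    {u : EuclideanSpace ℝ (Fin N) → ℝ} (hu : MemLp u (ENNReal.ofReal p)) :
    ∫⁻ x, ENNReal.ofReal (|u x| ^ embeddingExponent N s p) ≤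
      ENNReal.ofReal (embeddingConst N s p * (∫ y, |u y| ^ p) ^ (s * p / N)) *
        gagliardoPow N s p u := by
  have hp0 : 0 < p := by linarith
  have hnonneg : 0 ≤ ∫ y, |u y| ^ p := integral_nonneg fun y => by positivity
  rcases hnonneg.eq_or_lt with h0 | h0
  · have hu0 : ∀ᵐ x, |u x| ^ p = 0 := (integral_eq_zero_iff_of_nonneg
      (fun y => by positivity) (integrable_abs_rpow_of_memLp hp0 hu)).1 h0.symm
    refine le_of_eq_of_le (lintegral_eq_zero_of_ae_eq_zero ?_) zero_le
    filter_upwards [hu0] with x hx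
    rw [Real.rpow_eq_zero (abs_nonneg _) hp0.ne'] at hx
    simp [hx, Real.zero_rpow (hp0.trans (lt_embeddingExponent hs hp0)).ne']
  · calc _ ≤ ∫⁻ x, ENNReal.ofReal (embeddingConst N s p * (∫ y, |u y| ^ p) ^ (s * p / N)) *
          gagliardoDensity s p u x :=
        lintegral_mono fun x => abs_rpow_embeddingExponent_le hp hs hu h0 x
      _ = _ := lintegral_const_mul' _ _ ENNReal.ofReal_ne_top

theorem memLp_embeddingExponent [NeZero N] (hp : 1 ≤ p) (hs : 0 < s)
    {u : EuclideanSpace ℝ (Fin N) → ℝ} (hu : u ∈ W0 Ω s p) :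
    MemLp u (ENNReal.ofReal (embeddingExponent N s p)) := by
  have hq0 : 0 < embeddingExponent N s p :=
    (show 0 < p by linarith).trans (lt_embeddingExponent hs (by linarith))
  refine ⟨hu.1.1, (eLpNorm_lt_top_iff_lintegral_rpow_enorm_lt_top (by simpa using hq0)
    ENNReal.ofReal_ne_top).2 ?_⟩
  refine lt_of_eq_of_lt (lintegral_congr fun x => ?_)
    ((lintegral_abs_rpow_embeddingExponent_le hp hs hu.1).trans_lt
      (ENNReal.mul_lt_top ENNReal.ofReal_lt_top hu.2.1))
  rw [ENNReal.toReal_ofReal hq0.le, Real.enorm_eq_ofReal_abs,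
    ENNReal.ofReal_rpow_of_nonneg (abs_nonneg _) hq0.le]

theorem integral_abs_rpow_embeddingExponent_le [NeZero N] (hp : 1 ≤ p) (hs : 0 < s)
    {u : EuclideanSpace ℝ (Fin N) → ℝ} (hu : u ∈ W0 Ω s p) :
    ∫ x, |u x| ^ embeddingExponent N s p ≤
      embeddingConst N s p * normPow Ω p u ^ (s * p / N) * (gagliardoPow N s p u).toReal := by
  have hC : 0 < embeddingConst N s p := embeddingConst_pos
  have hnonneg : 0 ≤ normPow Ω p u := normPow_nonneg
  have hq0 : 0 < embeddingExponent N s p :=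
    (show 0 < p by linarith).trans (lt_embeddingExponent hs (by linarith))
  have hint := integrable_abs_rpow_of_memLp hq0 (memLp_embeddingExponent hp hs hu)
  rw [integral_eq_lintegral_of_nonneg_ae (Eventually.of_forall fun x => by positivity)
    hint.aestronglyMeasurable]
  refine ENNReal.toReal_le_of_le_ofReal (by positivity) ?_
  rw [ENNReal.ofReal_mul (by positivity), ENNReal.ofReal_toReal hu.2.1.ne,
    normPow_eq_integral (by linarith) hu]
  exact lintegral_abs_rpow_embeddingExponent_le hp hs hu.1

end GagliardoNirenberg

section Compactness

variable {N : ℕ} {s p : ℝ} {Ω : Set (EuclideanSpace ℝ (Fin N))}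

theorem normPow_le_sum_setAverage_add (hp : 1 ≤ p) (hs : 0 ≤ s) (hΩ : volume Ω ≠ ⊤)
    {u : EuclideanSpace ℝ (Fin N) → ℝ} (hu : u ∈ W0 Ω s p) {ι : Type*} {t : Finset ι}
    {c : ι → EuclideanSpace ℝ (Fin N)} {r : ℝ} (hr : 0 < r)
    (hcover : Ω ⊆ ⋃ i ∈ t, Metric.ball (c i) r) :
    normPow Ω p u ≤ 2 ^ (p - 1) *
      ((∑ i ∈ t, |⨍ y in Metric.ball (c i) r, u y| ^ p) * volume.real Ω +
        poincareConst N s p * r ^ (s * p) * (gagliardoPow N s p u).toReal) := by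
  have hK : 0 < poincareConst N s p := poincareConst_pos
  set S := ∑ i ∈ t, |⨍ y in Metric.ball (c i) r, u y| ^ p
  have hS : 0 ≤ S := Finset.sum_nonneg fun i _ => by positivity
  have hpt : ∀ x ∈ Ω, ENNReal.ofReal (|u x| ^ p) ≤ ENNReal.ofReal (2 ^ (p - 1)) *
      (ENNReal.ofReal S +
        ENNReal.ofReal (poincareConst N s p * r ^ (s * p)) * gagliardoDensity s p u x) := by
    intro x hx
    obtain ⟨i, hi, hxi⟩ := Set.mem_iUnion₂.1 (hcover hx)
    refine (abs_rpow_le_setAverage_add hp hs (hu.1.restrict _) hr hxi).trans ?_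
    gcongr
    exact Finset.single_le_sum (f := fun i => |⨍ y in Metric.ball (c i) r, u y| ^ p)
      (fun j _ => by positivity) hi
  rw [normPow, integral_eq_lintegral_of_nonneg_ae (Eventually.of_forall fun x => by positivity)
    (integrable_abs_rpow_of_memLp (by linarith) (hu.1.restrict Ω)).aestronglyMeasurable]
  refine ENNReal.toReal_le_of_le_ofReal (by positivity) ?_
  calc ∫⁻ x in Ω, ENNReal.ofReal (|u x| ^ p)
      ≤ ∫⁻ x in Ω, ENNReal.ofReal (2 ^ (p - 1)) * (ENNReal.ofReal S +
          ENNReal.ofReal (poincareConst N s p * r ^ (s * p)) * gagliardoDensity s p u x) := by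
        refine setLIntegral_mono_ae ?_ (Eventually.of_forall hpt)
        exact ((aemeasurable_gagliardoDensity hu.1.1.aemeasurable).restrict.const_mul _
          |>.const_add _).const_mul _
    _ = ENNReal.ofReal (2 ^ (p - 1)) * (ENNReal.ofReal S * volume Ω +
          ENNReal.ofReal (poincareConst N s p * r ^ (s * p)) *
            ∫⁻ x in Ω, gagliardoDensity s p u x) := by
        rw [lintegral_const_mul' _ _ ENNReal.ofReal_ne_top, lintegral_add_left measurable_const,
          setLIntegral_const, lintegral_const_mul' _ _ ENNReal.ofReal_ne_top]
    _ ≤ ENNReal.ofReal (2 ^ (p - 1)) * (ENNReal.ofReal S * volume Ω +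
          ENNReal.ofReal (poincareConst N s p * r ^ (s * p)) * gagliardoPow N s p u) := by
        gcongr
        exact setLIntegral_le_lintegral _ _
    _ = _ := by
        rw [ENNReal.ofReal_mul (p := 2 ^ (p - 1)) (by positivity),
          ENNReal.ofReal_add (by positivity) (by positivity),
          ENNReal.ofReal_mul hS, ofReal_measureReal hΩ,
          ENNReal.ofReal_mul (p := _ * r ^ (s * p)) (by positivity),
          ENNReal.ofReal_toReal hu.2.1.ne]

theorem exists_finset_subset_iUnion_ball_denseSeq {X : Type*} [MetricSpace X] [ProperSpace X]
    [Nonempty X] {t : Set X} (ht : Bornology.IsBounded t) {r : ℝ} (hr : 0 < r) :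
    ∃ I : Finset ℕ, t ⊆ ⋃ i ∈ I, Metric.ball (TopologicalSpace.denseSeq X i) r := by
  obtain ⟨I, hI⟩ := ht.isCompact_closure.elim_finite_subcover
    (fun i => Metric.ball (TopologicalSpace.denseSeq X i) r) (fun _ => Metric.isOpen_ball)
    fun x _ => by
      obtain ⟨i, hi⟩ := (TopologicalSpace.denseRange_denseSeq X).exists_dist_lt x hr
      exact Set.mem_iUnion.2 ⟨i, hi⟩
  exact ⟨I, subset_closure.trans hI⟩

theorem tendsto_normPow_of_tendsto_setAverage (hp : 1 ≤ p) (hs : 0 < s)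
    (hΩ : Bornology.IsBounded Ω) {ι : Type*} {l : Filter ι}
    {w : ι → EuclideanSpace ℝ (Fin N) → ℝ} (hw : ∀ i, w i ∈ W0 Ω s p) {K : ℝ}
    (hK : ∀ i, (gagliardoPow N s p (w i)).toReal ≤ K)
    (havg : ∀ j k : ℕ, Tendsto (fun i => ⨍ y in Metric.ball
      (TopologicalSpace.denseSeq (EuclideanSpace ℝ (Fin N)) j) (1 / ((k : ℝ) + 1)), w i y)
      l (𝓝 0)) :
    Tendsto (fun i => normPow Ω p (w i)) l (𝓝 0) := by
  refine tendsto_order.2 ⟨fun a ha => Eventually.of_forall fun i => ha.trans_le normPow_nonneg,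
    fun ε hε => ?_⟩
  have hsp : 0 < s * p := by positivity
  obtain ⟨k, hk⟩ : ∃ k : ℕ,
      2 ^ (p - 1) * (poincareConst N s p * (1 / ((k : ℝ) + 1)) ^ (s * p) * K) < ε := by
    have hlim := ((((tendsto_one_div_add_atTop_nhds_zero_nat (𝕜 := ℝ)).rpow_const
      (Or.inr hsp.le)).const_mul (poincareConst N s p)).mul_const K).const_mul (2 ^ (p - 1))
    rw [Real.zero_rpow hsp.ne', mul_zero, zero_mul, mul_zero] at hlim
    exact (hlim.eventually_lt_const hε).exists
  have hr : 0 < 1 / ((k : ℝ) + 1) := Nat.one_div_pos_of_nat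
  obtain ⟨I, hI⟩ := exists_finset_subset_iUnion_ball_denseSeq hΩ hr
  have hsum : Tendsto (fun i => ∑ j ∈ I, |⨍ y in Metric.ball
      (TopologicalSpace.denseSeq (EuclideanSpace ℝ (Fin N)) j) (1 / ((k : ℝ) + 1)), w i y| ^ p)
      l (𝓝 0) := by
    simpa [Real.zero_rpow (show p ≠ 0 by linarith)] using tendsto_finsetSum I fun j _ =>
      (havg j k).abs.rpow_const (Or.inr (show 0 ≤ p by linarith))
  have hbound := ((hsum.mul_const (volume.real Ω)).add_const
    (poincareConst N s p * (1 / ((k : ℝ) + 1)) ^ (s * p) * K)).const_mul (2 ^ (p - 1))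
  rw [zero_mul, zero_add] at hbound
  filter_upwards [hbound.eventually_lt_const hk] with i hi
  have hC : 0 < poincareConst N s p := poincareConst_pos
  refine (normPow_le_sum_setAverage_add hp hs.le hΩ.measure_lt_top.ne (hw i) hr hI).trans_lt
    (hi.trans_le' ?_)
  gcongr
  exact hK i

theorem exists_subseq_forall_tendsto {ι : Type*} [Countable ι] {a : ℕ → ι → ℝ} {b : ι → ℝ}
    (h : ∀ n i, |a n i| ≤ b i) :
    ∃ φ : ℕ → ℕ, StrictMono φ ∧ ∃ l : ι → ℝ, ∀ i, Tendsto (fun n => a (φ n) i) atTop (𝓝 (l i)) := by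
  obtain ⟨l, -, φ, hφ, hlim⟩ := (isCompact_univ_pi fun i => isCompact_Icc (a := -b i)
    (b := b i)).tendsto_subseq fun n i _ => abs_le.1 (h n i)
  exact ⟨φ, hφ, l, tendsto_pi_nhds.1 hlim⟩

theorem exists_subseq_tendsto_normPow_sub (hp : 1 ≤ p) (hs : 0 < s) (hΩ : Bornology.IsBounded Ω)
    {f : ℕ → EuclideanSpace ℝ (Fin N) → ℝ} (hf : ∀ n, f n ∈ W0 Ω s p) {K M : ℝ}
    (hK : ∀ n, (gagliardoPow N s p (f n)).toReal ≤ K) (hM : ∀ n, normPow Ω p (f n) ≤ M) :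
    ∃ φ : ℕ → ℕ, StrictMono φ ∧
      Tendsto (fun n : ℕ × ℕ => normPow Ω p (f (φ n.1) - f (φ n.2))) atTop (𝓝 0) := by
  have hp0 : 0 < p := by linarith
  set B : ℕ × ℕ → Set (EuclideanSpace ℝ (Fin N)) := fun i => Metric.ball
    (TopologicalSpace.denseSeq (EuclideanSpace ℝ (Fin N)) i.1) (1 / ((i.2 : ℝ) + 1)) with hB
  have hbdd : ∀ n i, |⨍ y in B i, f n y| ≤ ((volume.real (B i))⁻¹ * M) ^ p⁻¹ := fun n i => by
    have h := (abs_setAverage_ball_rpow_le hp (hf n).1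
      (TopologicalSpace.denseSeq (EuclideanSpace ℝ (Fin N)) i.1)
      (Nat.one_div_pos_of_nat (n := i.2))).trans
      (mul_le_mul_of_nonneg_left ((normPow_eq_integral hp0.ne' (hf n)).symm.trans_le (hM n))
        (by positivity))
    exact (Real.le_rpow_inv_iff_of_pos (abs_nonneg _)
      ((Real.rpow_nonneg (abs_nonneg _) _).trans h) hp0).2 h
  obtain ⟨φ, hφ, a, ha⟩ := exists_subseq_forall_tendsto hbdd
  refine ⟨φ, hφ, tendsto_normPow_of_tendsto_setAverage hp hs hΩ
    (fun n => sub_mem_W0 hp0 (hf (φ n.1)) (hf (φ n.2))) (K := 2 ^ (p - 1) * (K + K))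
    (fun n => (toReal_gagliardoPow_sub_le hp (hf _) (hf _)).trans
      (mul_le_mul_of_nonneg_left (add_le_add (hK _) (hK _)) (by positivity))) fun j k => ?_⟩
  have hint : ∀ n, IntegrableOn (f n) (B (j, k)) := fun n =>
    ((hf n).1.locallyIntegrable (by simpa using hp)).integrableOn_isCompact
      (isCompact_closedBall _ _) |>.mono_set Metric.ball_subset_closedBall
  have hsub := ((ha (j, k)).comp tendsto_fst).sub ((ha (j, k)).comp tendsto_snd)
  rw [sub_self, prod_atTop_atTop_eq] at hsub
  refine hsub.congr fun n => ?_
  simp only [Function.comp_apply, setAverage_eq, Pi.sub_apply, hB]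
  rw [integral_sub (hint _) (hint _), smul_sub]

theorem normPow_eq_norm_toLp_rpow (hp : 0 < p) {u : EuclideanSpace ℝ (Fin N) → ℝ}
    (hu : u ∈ W0 Ω s p) : normPow Ω p u = ‖hu.1.toLp u‖ ^ p := by
  have h0 : 0 ≤ ∫ x, ‖u x‖ ^ p := integral_nonneg fun _ => by positivity
  rw [Lp.norm_toLp, hu.1.eLpNorm_eq_integral_rpow_norm (by simpa using hp) ENNReal.ofReal_ne_top,
    ENNReal.toReal_ofReal hp.le, ENNReal.toReal_ofReal (by positivity),
    Real.rpow_inv_rpow h0 hp.ne', normPow_eq_integral hp.ne' hu]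
  simp only [Real.norm_eq_abs]

theorem exists_subseq_tendsto (hp : 1 ≤ p) (hs : 0 < s) (hΩ : Bornology.IsBounded Ω)
    {f : ℕ → EuclideanSpace ℝ (Fin N) → ℝ} (hf : ∀ n, f n ∈ W0 Ω s p) {K M : ℝ}
    (hK : ∀ n, (gagliardoPow N s p (f n)).toReal ≤ K) (hM : ∀ n, normPow Ω p (f n) ≤ M) :
    ∃ φ : ℕ → ℕ, StrictMono φ ∧ ∃ v ∈ W0 Ω s p,
      (∀ᵐ x, Tendsto (fun n => f (φ n) x) atTop (𝓝 (v x))) ∧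
      Tendsto (fun n => normPow Ω p (f (φ n))) atTop (𝓝 (normPow Ω p v)) := by
  have hp0 : 0 < p := by linarith
  have : Fact (1 ≤ ENNReal.ofReal p) := ⟨by simpa using hp⟩
  obtain ⟨φ, hφ, hlim⟩ := exists_subseq_tendsto_normPow_sub hp hs hΩ hf hK hM
  have hcauchy : CauchySeq fun n => (hf (φ n)).1.toLp (f (φ n)) := by
    have h := hlim.rpow_const (p := p⁻¹) (Or.inr (by positivity))
    rw [Real.zero_rpow (by positivity)] at h
    refine cauchySeq_iff_tendsto_dist_atTop_0.2 (h.congr fun n => ?_)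
    rw [normPow_eq_norm_toLp_rpow hp0 (sub_mem_W0 hp0 (hf (φ n.1)) (hf (φ n.2))),
      Real.rpow_rpow_inv (norm_nonneg _) hp0.ne', dist_eq_norm,
      MemLp.toLp_sub (hf (φ n.1)).1 (hf (φ n.2)).1]
  obtain ⟨g, hg⟩ := cauchySeq_tendsto_of_complete hcauchy
  obtain ⟨ψ, hψ, hae⟩ := (tendstoInMeasure_of_tendsto_Lp hg).exists_seq_tendsto_ae
  have hae' : ∀ᵐ x, Tendsto (fun n => f (φ (ψ n)) x) atTop (𝓝 (g x)) := by
    filter_upwards [hae, ae_all_iff.2 fun n => (hf (φ (ψ n))).1.coeFn_toLp] with x hx hcoe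
    exact hx.congr hcoe
  have hgW : (g : EuclideanSpace ℝ (Fin N) → ℝ) ∈ W0 Ω s p :=
    mem_W0_of_ae_tendsto hp0 (fun n => hf (φ (ψ n))) (fun n => hK _) (Lp.memLp g) hae'
  refine ⟨φ ∘ ψ, hφ.comp hψ, g, hgW, hae', ?_⟩
  have hnorm := ((hg.comp hψ.tendsto_atTop).norm).rpow_const (p := p) (Or.inr hp0.le)
  rw [normPow_eq_norm_toLp_rpow hp0 hgW, Lp.toLp_coeFn]
  exact hnorm.congr fun n => (normPow_eq_norm_toLp_rpow hp0 (hf _)).symm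

end Compactness

section Ray

variable {N : ℕ} {s p : ℝ} {Ω : Set (EuclideanSpace ℝ (Fin N))} {u : EuclideanSpace ℝ (Fin N) → ℝ}

theorem integrableOn_abs_rpow_mul_log [NeZero N] [IsFiniteMeasure (volume.restrict Ω)]
    (hp : 1 ≤ p) (hs : 0 < s) (hu : u ∈ W0 Ω s p) :
    IntegrableOn (fun x => |u x| ^ p * Real.log |u x|) Ω :=
  have hp0 : 0 < p := by linarith
  integrable_abs_rpow_mul_log hp0 (lt_embeddingExponent hs hp0)
    ((memLp_embeddingExponent hp hs hu).restrict Ω)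

theorem logTerm_smul [NeZero N] [IsFiniteMeasure (volume.restrict Ω)] (hp : 1 ≤ p) (hs : 0 < s)
    (hu : u ∈ W0 Ω s p) {l : ℝ} (hl : 0 < l) :
    logTerm Ω p (l • u) = l ^ p * (logTerm Ω p u + Real.log l * normPow Ω p u) := by
  have hp0 : 0 < p := by linarith
  rw [logTerm, logTerm, normPow, ← integral_const_mul, ← integral_add
    (integrableOn_abs_rpow_mul_log hp hs hu)
    ((integrable_abs_rpow_of_memLp hp0 (hu.1.restrict Ω)).const_mul _), ← integral_const_mul]
  congr 1 with x
  rw [Pi.smul_apply, smul_eq_mul, abs_mul, abs_of_pos hl]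
  rcases eq_or_ne (u x) 0 with h | h
  · simp [h, Real.zero_rpow hp0.ne']
  · rw [Real.mul_rpow hl.le (abs_nonneg _), Real.log_mul hl.ne' (abs_ne_zero.2 h)]
    ring

theorem nehariFunctional_smul [NeZero N] [IsFiniteMeasure (volume.restrict Ω)] (hp : 1 ≤ p)
    (hs : 0 < s) (hu : u ∈ W0 Ω s p) {l : ℝ} (hl : 0 < l) :
    nehariFunctional Ω s p (l • u) =
      l ^ p * (nehariFunctional Ω s p u - Real.log l * normPow Ω p u) := by
  rw [nehariFunctional, nehariFunctional, toReal_gagliardoPow_smul, normPow_smul,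
    logTerm_smul hp hs hu hl, abs_of_pos hl]
  ring

theorem energy_eq_nehariFunctional_add :
    energy Ω s p u = 1 / p * nehariFunctional Ω s p u + 1 / p ^ 2 * normPow Ω p u := by
  rw [energy, nehariFunctional]
  ring

theorem energy_of_mem_nehari (hu : u ∈ nehari Ω s p) :
    energy Ω s p u = 1 / p ^ 2 * normPow Ω p u := by
  rw [energy_eq_nehariFunctional_add, hu.2, mul_zero, zero_add]

/-- The factor that projects `u` along its ray to the Nehari manifold. -/
def rayScale (Ω : Set (EuclideanSpace ℝ (Fin N))) (s p : ℝ)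
    (u : EuclideanSpace ℝ (Fin N) → ℝ) : ℝ :=
  Real.exp (nehariFunctional Ω s p u / normPow Ω p u)

/-- The maximum of the energy along the ray through `u`. -/
def rayMax (Ω : Set (EuclideanSpace ℝ (Fin N))) (s p : ℝ)
    (u : EuclideanSpace ℝ (Fin N) → ℝ) : ℝ :=
  1 / p ^ 2 * (rayScale Ω s p u ^ p * normPow Ω p u)

theorem rayScale_pos : 0 < rayScale Ω s p u := Real.exp_pos _

theorem rayMax_of_mem_nehari (hu : u ∈ nehari Ω s p) : rayMax Ω s p u = energy Ω s p u := by
  rw [energy_of_mem_nehari hu, rayMax, rayScale, hu.2, zero_div, Real.exp_zero, Real.one_rpow,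
    one_mul]

theorem rayScale_smul_mem_nehari [NeZero N] [IsFiniteMeasure (volume.restrict Ω)] (hp : 1 ≤ p)
    (hs : 0 < s) (hu : u ∈ X0 Ω s p) : rayScale Ω s p u • u ∈ nehari Ω s p := by
  have hp0 : 0 < p := by linarith
  refine ⟨smul_mem_X0 hp0 hu rayScale_pos, ?_⟩
  rw [nehariFunctional_smul hp hs hu.1 rayScale_pos, rayScale, Real.log_exp,
    div_mul_cancel₀ _ (normPow_pos hp0 hu).ne', sub_self, mul_zero]

theorem energy_rayScale_smul [NeZero N] [IsFiniteMeasure (volume.restrict Ω)] (hp : 1 ≤ p)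
    (hs : 0 < s) (hu : u ∈ X0 Ω s p) :
    energy Ω s p (rayScale Ω s p u • u) = rayMax Ω s p u := by
  rw [energy_of_mem_nehari (rayScale_smul_mem_nehari hp hs hu), normPow_smul, rayMax,
    abs_of_pos rayScale_pos]

theorem energy_smul_eq_rayMax_mul [NeZero N] [IsFiniteMeasure (volume.restrict Ω)] (hp : 1 ≤ p)
    (hs : 0 < s) (hu : u ∈ X0 Ω s p) {l : ℝ} (hl : 0 < l) :
    energy Ω s p (l • u) = rayMax Ω s p u *
      ((l / rayScale Ω s p u) ^ p * (1 - Real.log ((l / rayScale Ω s p u) ^ p))) := by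
  have hm := normPow_pos (by linarith) hu
  have hR : 0 < rayScale Ω s p u := rayScale_pos
  have hlog : Real.log (rayScale Ω s p u) * normPow Ω p u = nehariFunctional Ω s p u := by
    rw [rayScale, Real.log_exp, div_mul_cancel₀ _ hm.ne']
  rw [energy_eq_nehariFunctional_add, nehariFunctional_smul hp hs hu.1 hl, normPow_smul, rayMax,
    abs_of_pos hl, ← hlog, Real.log_rpow (by positivity), Real.log_div hl.ne' hR.ne',
    Real.div_rpow hl.le hR.le]
  field_simp
  ring

theorem mul_one_sub_log_le_one {y : ℝ} (hy : 0 < y) : y * (1 - Real.log y) ≤ 1 := by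
  have h := mul_le_mul_of_nonneg_left (Real.one_sub_inv_le_log_of_pos hy) hy.le
  rw [mul_sub, mul_inv_cancel₀ hy.ne'] at h
  linarith

theorem rayMax_nonneg : 0 ≤ rayMax Ω s p u :=
  mul_nonneg (by positivity) (mul_nonneg (Real.rpow_nonneg rayScale_pos.le _) normPow_nonneg)

theorem energy_smul_le_rayMax [NeZero N] [IsFiniteMeasure (volume.restrict Ω)] (hp : 1 ≤ p)
    (hs : 0 < s) (hu : u ∈ X0 Ω s p) {l : ℝ} (hl : 0 < l) :
    energy Ω s p (l • u) ≤ rayMax Ω s p u := by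
  rw [energy_smul_eq_rayMax_mul hp hs hu hl]
  exact mul_le_of_le_one_right rayMax_nonneg
    (mul_one_sub_log_le_one (Real.rpow_pos_of_pos (div_pos hl rayScale_pos) p))

theorem depth_le_rayMax [NeZero N] [IsFiniteMeasure (volume.restrict Ω)] (hp : 1 ≤ p)
    (hs : 0 < s) (hu : u ∈ X0 Ω s p) : depth Ω s p ≤ rayMax Ω s p u := by
  rw [← energy_rayScale_smul hp hs hu]
  exact iInf₂_le _ (rayScale_smul_mem_nehari hp hs hu)

theorem iSup_energy_smul [NeZero N] [IsFiniteMeasure (volume.restrict Ω)] (hp : 1 ≤ p)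
    (hs : 0 < s) (hu : u ∈ X0 Ω s p) :
    ⨆ (l : ℝ) (_ : 0 < l), (energy Ω s p (l • u) : EReal) = rayMax Ω s p u := by
  refine le_antisymm (iSup₂_le fun l hl => ?_) ?_
  · exact_mod_cast energy_smul_le_rayMax hp hs hu hl
  · rw [← energy_rayScale_smul hp hs hu]
    exact le_iSup₂ (f := fun (l : ℝ) (_ : 0 < l) => (energy Ω s p (l • u) : EReal))
      (rayScale Ω s p u) rayScale_pos

theorem depth_eq_iInf_iSup [NeZero N] [IsFiniteMeasure (volume.restrict Ω)] (hp : 1 ≤ p)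
    (hs : 0 < s) : depth Ω s p =
      ⨅ u ∈ X0 Ω s p, ⨆ (l : ℝ) (_ : 0 < l), (energy Ω s p (l • u) : EReal) := by
  refine le_antisymm (le_iInf₂ fun u hu => ?_) (le_iInf₂ fun u hu => ?_)
  · rw [iSup_energy_smul hp hs hu]
    exact depth_le_rayMax hp hs hu
  · rw [← rayMax_of_mem_nehari hu, ← iSup_energy_smul hp hs hu.1]
    exact iInf₂_le u hu.1

end Ray

section LogEstimate

variable {N : ℕ} {s p : ℝ} {Ω : Set (EuclideanSpace ℝ (Fin N))} {u : EuclideanSpace ℝ (Fin N) → ℝ}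

theorem exists_logTerm_le_of_normPow_eq_one [NeZero N] (Ω : Set (EuclideanSpace ℝ (Fin N)))
    [IsFiniteMeasure (volume.restrict Ω)] (hp : 1 ≤ p) (hs : 0 < s) {ε : ℝ} (hε : 0 < ε) :
    ∃ C : ℝ, ∀ u ∈ W0 Ω s p, normPow Ω p u = 1 →
      logTerm Ω p u ≤ ε * (gagliardoPow N s p u).toReal + C := by
  have hp0 : 0 < p := by linarith
  have hc : 0 < embeddingConst N s p := embeddingConst_pos
  have hpq : p < embeddingExponent N s p := lt_embeddingExponent hs hp0
  obtain ⟨A, -, hA⟩ := exists_abs_rpow_mul_log_le hp0 hpq (div_pos hε hc)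
  refine ⟨A * volume.real Ω, fun u hu hm => ?_⟩
  have hint : Integrable (fun x => |u x| ^ embeddingExponent N s p) :=
    integrable_abs_rpow_of_memLp (hp0.trans hpq) (memLp_embeddingExponent hp hs hu)
  have hembed : ∫ x, |u x| ^ embeddingExponent N s p ≤
      embeddingConst N s p * (gagliardoPow N s p u).toReal := by
    simpa [hm] using integral_abs_rpow_embeddingExponent_le hp hs hu
  calc logTerm Ω p u
      ≤ ∫ x in Ω, (ε / embeddingConst N s p * |u x| ^ embeddingExponent N s p + A) :=
        integral_mono (integrableOn_abs_rpow_mul_log hp hs hu)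
          ((hint.integrableOn.const_mul _).add (integrable_const _)) fun x => hA (u x)
    _ = ε / embeddingConst N s p * (∫ x in Ω, |u x| ^ embeddingExponent N s p) +
          A * volume.real Ω := by
        rw [integral_add (hint.integrableOn.const_mul _) (integrable_const _), integral_const_mul,
          setIntegral_const, smul_eq_mul, mul_comm A]
    _ ≤ ε / embeddingConst N s p * (embeddingConst N s p * (gagliardoPow N s p u).toReal) +
          A * volume.real Ω := by
        refine add_le_add_left (mul_le_mul_of_nonneg_left ?_ (by positivity)) _
        exact (setIntegral_le_integral hint (Eventually.of_forall fun x => by positivity)).trans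
          hembed
    _ = _ := by rw [← mul_assoc, div_mul_cancel₀ _ hc.ne']

theorem normPow_rpow_neg_inv_smul (hp : 0 < p) (hu : u ∈ X0 Ω s p) :
    normPow Ω p ((normPow Ω p u ^ (-p⁻¹)) • u) = 1 := by
  have hm := normPow_pos hp hu
  rw [normPow_smul, abs_of_pos (by positivity), ← Real.rpow_mul hm.le, neg_mul,
    inv_mul_cancel₀ hp.ne', Real.rpow_neg_one, inv_mul_cancel₀ hm.ne']

/-- Obtained from its version on the `L^p`-sphere by scaling. -/
theorem exists_logTerm_le_add_mul_log [NeZero N] (Ω : Set (EuclideanSpace ℝ (Fin N)))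
    [IsFiniteMeasure (volume.restrict Ω)] (hp : 1 ≤ p) (hs : 0 < s) {ε : ℝ} (hε : 0 < ε) :
    ∃ C : ℝ, ∀ u ∈ X0 Ω s p, logTerm Ω p u ≤ ε * (gagliardoPow N s p u).toReal +
      (C * normPow Ω p u + normPow Ω p u * Real.log (normPow Ω p u) / p) := by
  have hp0 : 0 < p := by linarith
  obtain ⟨C, hC⟩ := exists_logTerm_le_of_normPow_eq_one Ω hp hs hε
  refine ⟨C, fun u hu => ?_⟩
  have hm := normPow_pos hp0 hu
  have hl : 0 < normPow Ω p u ^ (-p⁻¹) := by positivity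
  have hsphere := hC _ (smul_mem_X0 hp0 hu hl).1 (normPow_rpow_neg_inv_smul hp0 hu)
  have hlp : (normPow Ω p u ^ (-p⁻¹)) ^ p = (normPow Ω p u)⁻¹ := by
    rw [← Real.rpow_mul hm.le, neg_mul, inv_mul_cancel₀ hp0.ne', Real.rpow_neg_one]
  rw [logTerm_smul hp hs hu.1 hl, toReal_gagliardoPow_smul, abs_of_pos hl, hlp,
    Real.log_rpow hm] at hsphere
  have hscaled := mul_le_mul_of_nonneg_left hsphere hm.le
  field_simp at hscaled ⊢
  linarith

theorem mul_add_mul_log_div_le {m C γ : ℝ} (hm : 0 < m) (hp : 0 < p) (hγ : 1 < γ) :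
    C * m + m * Real.log m / p ≤ Real.exp (p * C) ^ (γ - 1) / (p * (γ - 1)) * m ^ γ := by
  have hγ0 : 0 < γ - 1 := sub_pos.2 hγ
  calc C * m + m * Real.log m / p = m / p * Real.log (Real.exp (p * C) * m) := by
        rw [Real.log_mul (Real.exp_pos _).ne' hm.ne', Real.log_exp]
        field_simp
    _ ≤ m / p * ((Real.exp (p * C) * m) ^ (γ - 1) / (γ - 1)) := by
        gcongr
        exact Real.log_le_rpow_div (by positivity) hγ0
    _ = _ := by
        rw [Real.mul_rpow (Real.exp_pos _).le hm.le, Real.rpow_sub_one hm.ne' γ]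
        field_simp

theorem exists_logEstimate [NeZero N] (Ω : Set (EuclideanSpace ℝ (Fin N)))
    [IsFiniteMeasure (volume.restrict Ω)] (hp : 1 ≤ p) (hs : 0 < s) {ε γ : ℝ} (hε : 0 < ε)
    (hγ : 1 < γ) : ∃ C : ℝ, LogEstimate Ω s p ε γ C := by
  have hp0 : 0 < p := by linarith
  obtain ⟨C, hC⟩ := exists_logTerm_le_add_mul_log Ω hp hs hε
  refine ⟨Real.exp (p * C) ^ (γ - 1) / (p * (γ - 1)), ?_, fun u hu => (hC u hu).trans
    (add_le_add_right (mul_add_mul_log_div_le (normPow_pos hp0 hu) hp0 hγ) _)⟩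
  have := sub_pos.2 hγ
  positivity

theorem radius_rpow {γ C : ℝ} (hp : p ≠ 0) (hC : 0 < C) :
    radius p γ C ^ p = (1 / C) ^ (γ - 1)⁻¹ := by
  rw [radius, ← Real.rpow_mul (by positivity), one_div (p * _), mul_inv, mul_right_comm,
    inv_mul_cancel₀ hp, one_mul]

theorem radius_rpow_pos {γ C : ℝ} (hC : 0 < C) : 0 < radius p γ C ^ p :=
  Real.rpow_pos_of_pos (Real.rpow_pos_of_pos (one_div_pos.2 hC) _) _

theorem radius_rpow_le_normPow {ε γ C : ℝ} (hp : 0 < p) (hε : ε ≤ 1) (hγ : 1 < γ)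
    (hC : LogEstimate Ω s p ε γ C) (hu : u ∈ nehari Ω s p) :
    radius p γ C ^ p ≤ normPow Ω p u := by
  have hm := normPow_pos hp hu.1
  have hγ0 : 0 < γ - 1 := sub_pos.2 hγ
  have hlog : normPow Ω p u ≤ C * normPow Ω p u ^ γ := by
    have hI := hu.2
    rw [nehariFunctional] at hI
    have hgag := mul_le_of_le_one_left (ENNReal.toReal_nonneg (a := gagliardoPow N s p u)) hε
    linarith [hC.2 u hu.1]
  rw [radius_rpow hp.ne' hC.1, Real.rpow_inv_le_iff_of_pos (one_div_pos.2 hC.1).le hm.le hγ0,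
    div_le_iff₀' hC.1, Real.rpow_sub_one hm.ne', mul_div_assoc', one_le_div hm]
  exact hlog

theorem le_depth_of_logEstimate {ε γ C : ℝ} (hp : 0 < p) (hε : ε ≤ 1) (hγ : 1 < γ)
    (hC : LogEstimate Ω s p ε γ C) : ((radius p γ C ^ p / p ^ 2 : ℝ) : EReal) ≤ depth Ω s p := by
  refine le_iInf₂ fun u hu => EReal.coe_le_coe_iff.2 ?_
  rw [energy_of_mem_nehari hu, one_div_mul_eq_div]
  gcongr
  exact radius_rpow_le_normPow hp hε hγ hC hu

theorem one_lt_interpolation_exponent {n ϱ θ γ : ℝ} (hs : 0 < s) (hp : 0 < p) (hn : s * p < n)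
    (hϱ : 0 < ϱ) (hϱ' : ϱ < s * p ^ 2 / n)
    (hθ : 1 / (p + ϱ) = (1 - θ) / p + θ / (n * p / (n - s * p)))
    (hγ : γ = (1 - θ) * (p + ϱ) / (p - θ * (p + ϱ))) : 1 < γ := by
  have hn0 : 0 < n := hn.trans' (by positivity)
  have hd : 0 < n - s * p := sub_pos.2 hn
  have hθϱ : θ * (p + ϱ) = n * ϱ / (s * p) := by
    field_simp at hθ ⊢
    linarith
  have hlt : n * ϱ / (s * p) < p := by
    rw [lt_div_iff₀ hn0] at hϱ'
    rw [div_lt_iff₀ (by positivity)]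
    linarith
  rw [hγ, hθϱ, one_lt_div (by linarith), sub_mul, one_mul, hθϱ]
  linarith

end LogEstimate

section Minimizer

variable {N : ℕ} {s p : ℝ} {Ω : Set (EuclideanSpace ℝ (Fin N))}

theorem eventually_logTerm_lt [NeZero N] [IsFiniteMeasure (volume.restrict Ω)] (hp : 1 < p)
    (hs : 0 < s) {f : ℕ → EuclideanSpace ℝ (Fin N) → ℝ} {v : EuclideanSpace ℝ (Fin N) → ℝ}
    (hf : ∀ n, f n ∈ W0 Ω s p) (hv : v ∈ W0 Ω s p) {K M : ℝ}
    (hK : ∀ n, (gagliardoPow N s p (f n)).toReal ≤ K) (hM : ∀ n, normPow Ω p (f n) ≤ M)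
    (hlim : ∀ᵐ x, Tendsto (fun n => f n x) atTop (𝓝 (v x))) {a : ℝ} (ha : logTerm Ω p v < a) :
    ∀ᶠ n in atTop, logTerm Ω p (f n) < a := by
  have hp0 : 0 < p := by linarith
  have hpq : p < embeddingExponent N s p := lt_embeddingExponent hs hp0
  have hLq {w} (hw : w ∈ W0 Ω s p) : MemLp w (ENNReal.ofReal (embeddingExponent N s p)) :=
    memLp_embeddingExponent hp.le hs hw
  refine eventually_integral_comp_lt_of_ae_tendsto (μ := volume.restrict Ω)
    (continuous_abs_rpow_mul_log hp) (hp0.trans hpq)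
    (fun η hη => (exists_abs_rpow_mul_log_le hp0 hpq hη).imp fun A hA => hA.2)
    (fun n => (hLq (hf n)).restrict Ω) ((hLq hv).restrict Ω)
    (fun n => integrableOn_abs_rpow_mul_log hp.le hs (hf n))
    (integrableOn_abs_rpow_mul_log hp.le hs hv)
    (Q := embeddingConst N s p * M ^ (s * p / N) * K) (fun n => ?_) (ae_restrict_of_ae hlim) ha
  have hc : 0 < embeddingConst N s p := embeddingConst_pos
  have hm : 0 ≤ normPow Ω p (f n) := normPow_nonneg
  calc ∫ x in Ω, |f n x| ^ embeddingExponent N s p ≤ ∫ x, |f n x| ^ embeddingExponent N s p :=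
        setIntegral_le_integral (integrable_abs_rpow_of_memLp (hp0.trans hpq) (hLq (hf n)))
          (.of_forall fun x => by positivity)
    _ ≤ _ := integral_abs_rpow_embeddingExponent_le hp.le hs (hf n)
    _ ≤ _ := by
        have := hm.trans (hM n)
        gcongr
        exacts [hM n, hK n]

theorem nehariFunctional_nonpos_of_tendsto [NeZero N] [IsFiniteMeasure (volume.restrict Ω)]
    (hp : 1 < p) (hs : 0 < s) {f : ℕ → EuclideanSpace ℝ (Fin N) → ℝ}
    {v : EuclideanSpace ℝ (Fin N) → ℝ} (hf : ∀ n, f n ∈ nehari Ω s p) (hv : v ∈ W0 Ω s p) {K M : ℝ}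
    (hK : ∀ n, (gagliardoPow N s p (f n)).toReal ≤ K) (hM : ∀ n, normPow Ω p (f n) ≤ M)
    (hlim : ∀ᵐ x, Tendsto (fun n => f n x) atTop (𝓝 (v x)))
    (hnorm : Tendsto (fun n => normPow Ω p (f n)) atTop (𝓝 (normPow Ω p v))) :
    nehariFunctional Ω s p v ≤ 0 := by
  by_contra! hpos
  have hf0 n := (hf n).1.1
  have hgag := eventually_lt_toReal_gagliardoPow (by linarith) hf0 hv hlim
    (sub_lt_self _ (by linarith : 0 < nehariFunctional Ω s p v / 3))
  have hlog := eventually_logTerm_lt hp hs hf0 hv hK hM hlim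
    (lt_add_of_pos_right _ (by linarith : 0 < nehariFunctional Ω s p v / 3))
  have hnorm' := hnorm.eventually_const_lt
    (sub_lt_self _ (by linarith : 0 < nehariFunctional Ω s p v / 3))
  obtain ⟨n, hn₁, hn₂, hn₃⟩ := (hgag.and (hlog.and hnorm')).exists
  have hI := (hf n).2
  rw [nehariFunctional] at hI hn₁ hn₂ hn₃
  linarith

theorem rayMax_le_of_nehariFunctional_nonpos (hp : 0 < p) {u : EuclideanSpace ℝ (Fin N) → ℝ}
    (hI : nehariFunctional Ω s p u ≤ 0) : rayMax Ω s p u ≤ 1 / p ^ 2 * normPow Ω p u := by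
  have hscale : rayScale Ω s p u ≤ 1 :=
    Real.exp_le_one_iff.2 (div_nonpos_of_nonpos_of_nonneg hI normPow_nonneg)
  rw [rayMax]
  gcongr
  exact mul_le_of_le_one_left normPow_nonneg (Real.rpow_le_one rayScale_pos.le hscale hp.le)

theorem exists_forall_mem_nehari_toReal_gagliardoPow_le [NeZero N]
    (Ω : Set (EuclideanSpace ℝ (Fin N))) [IsFiniteMeasure (volume.restrict Ω)] (hp : 1 ≤ p)
    (hs : 0 < s) (M : ℝ) : ∃ K : ℝ, ∀ u ∈ nehari Ω s p, normPow Ω p u ≤ M →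
      (gagliardoPow N s p u).toReal ≤ K := by
  obtain ⟨C, hC₀, hC⟩ := exists_logEstimate Ω hp hs one_half_pos one_lt_two
  refine ⟨2 * (C * M ^ (2 : ℝ)), fun u hu hM => ?_⟩
  have hm : 0 ≤ normPow Ω p u := normPow_nonneg
  have hle : C * normPow Ω p u ^ (2 : ℝ) ≤ C * M ^ (2 : ℝ) := by gcongr
  have hI := hu.2
  rw [nehariFunctional] at hI
  linarith [hC u hu.1]

theorem exists_forall_mem_nehari_pos_le_normPow [NeZero N]
    (Ω : Set (EuclideanSpace ℝ (Fin N))) [IsFiniteMeasure (volume.restrict Ω)] (hp : 1 ≤ p)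
    (hs : 0 < s) : ∃ r > 0, ∀ u ∈ nehari Ω s p, r ≤ normPow Ω p u := by
  obtain ⟨C, hC⟩ := exists_logEstimate Ω hp hs one_pos one_lt_two
  exact ⟨radius p 2 C ^ p, radius_rpow_pos hC.1, fun u hu =>
    radius_rpow_le_normPow (by linarith) le_rfl one_lt_two hC hu⟩

theorem nehari_nonempty [NeZero N] [IsFiniteMeasure (volume.restrict Ω)] (hp : 1 ≤ p)
    (hs : 0 < s) (hne : (X0 Ω s p).Nonempty) : (nehari Ω s p).Nonempty :=
  let ⟨_, hu⟩ := hne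
  ⟨_, rayScale_smul_mem_nehari hp hs hu⟩

theorem exists_isMinOn_energy_nehari [NeZero N] (hp : 1 < p) (hs : 0 < s)
    (hΩ : Bornology.IsBounded Ω) (hne : (X0 Ω s p).Nonempty) :
    ∃ u ∈ nehari Ω s p, IsMinOn (energy Ω s p) (nehari Ω s p) u := by
  have : IsFiniteMeasure (volume.restrict Ω) :=
    isFiniteMeasure_restrict.2 hΩ.measure_lt_top.ne
  have hbdd : BddBelow (normPow Ω p '' nehari Ω s p) :=
    ⟨0, Set.forall_mem_image.2 fun u _ => normPow_nonneg⟩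
  obtain ⟨a, hanti, hlim, ha⟩ :=
    exists_seq_tendsto_sInf ((nehari_nonempty hp.le hs hne).image _) hbdd
  choose f hf hfa using ha
  have hM n : normPow Ω p (f n) ≤ a 0 := (hfa n).trans_le (hanti n.zero_le)
  obtain ⟨K, hK⟩ := exists_forall_mem_nehari_toReal_gagliardoPow_le Ω hp.le hs (a 0)
  have hK' n := hK (f n) (hf n) (hM n)
  obtain ⟨φ, hφ, v, hv, hae, hnorm⟩ := exists_subseq_tendsto hp.le hs hΩ (fun n => (hf n).1.1)
    hK' hM
  obtain ⟨r, hr, hrle⟩ := exists_forall_mem_nehari_pos_le_normPow Ω hp.le hs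
  have hvX : v ∈ X0 Ω s p := (mem_X0_iff_normPow_pos (by linarith) hv).2 <|
    hr.trans_le (ge_of_tendsto' hnorm fun n => hrle _ (hf (φ n)))
  have hvmin : normPow Ω p v = sInf (normPow Ω p '' nehari Ω s p) :=
    tendsto_nhds_unique hnorm
      ((hlim.comp hφ.tendsto_atTop).congr fun n => (hfa (φ n)).symm)
  have hI := nehariFunctional_nonpos_of_tendsto hp hs (fun n => hf (φ n)) hv
    (fun n => hK' (φ n)) (fun n => hM (φ n)) hae hnorm
  refine ⟨_, rayScale_smul_mem_nehari hp.le hs hvX, fun w hw => ?_⟩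
  calc energy Ω s p (rayScale Ω s p v • v) = rayMax Ω s p v := energy_rayScale_smul hp.le hs hvX
    _ ≤ 1 / p ^ 2 * normPow Ω p v := rayMax_le_of_nehariFunctional_nonpos (by linarith) hI
    _ ≤ 1 / p ^ 2 * normPow Ω p w := by
        rw [hvmin]
        gcongr
        exact csInf_le hbdd (Set.mem_image_of_mem _ hw)
    _ = energy Ω s p w := (energy_of_mem_nehari hw).symm

theorem energy_eq_depth {u : EuclideanSpace ℝ (Fin N) → ℝ} (hu : u ∈ nehari Ω s p)
    (hmin : IsMinOn (energy Ω s p) (nehari Ω s p) u) : (energy Ω s p u : EReal) = depth Ω s p :=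
  le_antisymm (le_iInf₂ fun _ hw => EReal.coe_le_coe_iff.2 (hmin hw)) (iInf₂_le u hu)

theorem energy_le_rayMax_of_isMinOn [NeZero N] [IsFiniteMeasure (volume.restrict Ω)] (hp : 1 ≤ p)
    (hs : 0 < s) {u w : EuclideanSpace ℝ (Fin N) → ℝ}
    (hmin : IsMinOn (energy Ω s p) (nehari Ω s p) u) (hw : w ∈ X0 Ω s p) :
    energy Ω s p u ≤ rayMax Ω s p w := by
  rw [← energy_rayScale_smul hp hs hw]
  exact hmin (rayScale_smul_mem_nehari hp hs hw)

end Minimizer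

section CriticalPoint

variable {N : ℕ} {s p : ℝ} {Ω : Set (EuclideanSpace ℝ (Fin N))} {u v : EuclideanSpace ℝ (Fin N) → ℝ}

/-- The first variation of the energy at `u` in the direction `v`. -/
def firstVariation (Ω : Set (EuclideanSpace ℝ (Fin N))) (s p : ℝ)
    (u v : EuclideanSpace ℝ (Fin N) → ℝ) : ℝ :=
  formK N s p u v + (∫ x in Ω, |u x| ^ (p - 2) * u x * v x) -
    ∫ x in Ω, |u x| ^ (p - 2) * u x * Real.log |u x| * v x

theorem isStationarySolution_iff_firstVariation : IsStationarySolution Ω s p u ↔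
    u ∈ W0 Ω s p ∧ ∀ v ∈ W0 Ω s p, firstVariation Ω s p u v = 0 := by
  simp only [IsStationarySolution, firstVariation, sub_eq_zero]

theorem hasDerivAt_logTerm [NeZero N] [IsFiniteMeasure (volume.restrict Ω)] (hp : 1 < p)
    (hs : 0 < s) (hu : u ∈ W0 Ω s p) (hv : v ∈ W0 Ω s p) :
    HasDerivAt (fun t : ℝ => logTerm Ω p (u + t • v))
      (p * (∫ x in Ω, |u x| ^ (p - 2) * u x * Real.log |u x| * v x) +
        ∫ x in Ω, |u x| ^ (p - 2) * u x * v x) 0 :=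
  (hasDerivAt_integral_abs_rpow_mul_log hp (lt_embeddingExponent hs (by linarith))
    ((memLp_embeddingExponent hp.le hs hu).restrict Ω)
    ((memLp_embeddingExponent hp.le hs hv).restrict Ω)).2

theorem hasDerivAt_nehariFunctional [NeZero N] [IsFiniteMeasure (volume.restrict Ω)] (hp : 1 < p)
    (hs : 0 < s) (hu : u ∈ W0 Ω s p) (hv : v ∈ W0 Ω s p) :
    HasDerivAt (fun t : ℝ => nehariFunctional Ω s p (u + t • v))
      (p * firstVariation Ω s p u v - ∫ x in Ω, |u x| ^ (p - 2) * u x * v x) 0 := by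
  refine (((hasDerivAt_gagliardoPow hp hu hv).add (hasDerivAt_normPow hp hu hv)).sub
    (hasDerivAt_logTerm hp hs hu hv)).congr_deriv ?_
  rw [firstVariation]
  ring

theorem hasDerivAt_energy [NeZero N] [IsFiniteMeasure (volume.restrict Ω)] (hp : 1 < p)
    (hs : 0 < s) (hu : u ∈ W0 Ω s p) (hv : v ∈ W0 Ω s p) :
    HasDerivAt (fun t : ℝ => energy Ω s p (u + t • v)) (firstVariation Ω s p u v) 0 := by
  simp only [energy_eq_nehariFunctional_add]
  refine (((hasDerivAt_nehariFunctional hp hs hu hv).const_mul (1 / p)).add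
    ((hasDerivAt_normPow hp hu hv).const_mul (1 / p ^ 2))).congr_deriv ?_
  field_simp
  ring

theorem isCriticalPoint_iff_isStationarySolution [NeZero N] [IsFiniteMeasure (volume.restrict Ω)]
    (hp : 1 < p) (hs : 0 < s) : IsCriticalPoint Ω s p u ↔ IsStationarySolution Ω s p u := by
  rw [IsCriticalPoint, isStationarySolution_iff_firstVariation]
  refine and_congr_right fun hu => forall₂_congr fun v hv => ?_
  have hE := hasDerivAt_energy hp hs hu hv
  exact ⟨hE.unique, fun h => h ▸ hE⟩

theorem firstVariation_self (hp : 0 < p) (hu : u ∈ W0 Ω s p) :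
    firstVariation Ω s p u u = nehariFunctional Ω s p u := by
  have hform : formK N s p u u = (gagliardoPow N s p u).toReal := by
    rw [toReal_gagliardoPow hp.ne' hu.1.1.aemeasurable, Measure.volume_eq_prod,
      integral_prod _ (integrable_abs_rpow_of_memLp hp (memLp_diffQuot hp hu)), formK]
    simp only [← abs_diffQuot_rpow_sub_two_mul_mul hp.ne',
      abs_rpow_sub_two_mul_self_mul_self _ hp.ne']
  rw [firstVariation, nehariFunctional, hform, normPow, logTerm]
  simp only [mul_right_comm _ (Real.log _), abs_rpow_sub_two_mul_self_mul_self _ hp.ne']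

theorem mem_nehari_of_isStationarySolution (hp : 0 < p) (hu : u ∈ X0 Ω s p)
    (hsol : IsStationarySolution Ω s p u) : u ∈ nehari Ω s p :=
  ⟨hu, by
    rw [← firstVariation_self hp hu.1]
    exact (isStationarySolution_iff_firstVariation.1 hsol).2 u hu.1⟩

theorem eventually_add_smul_mem_X0 (hp : 1 < p) (hu : u ∈ X0 Ω s p) (hv : v ∈ W0 Ω s p) :
    ∀ᶠ t : ℝ in 𝓝 0, u + t • v ∈ X0 Ω s p := by
  have hp0 : 0 < p := by linarith
  filter_upwards [(hasDerivAt_normPow hp hu.1 hv).continuousAt.eventually_const_lt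
    (by simpa using normPow_pos hp0 hu)] with t ht
  exact (mem_X0_iff_normPow_pos hp0 (add_smul_mem_W0 hp0 hu.1 hv t)).2 ht

/-- On the Nehari manifold the `∫ |u|^(p-2) u v` contributed by the derivative of the exponential
factor of `rayMax` cancels the one contributed by the derivative of `normPow`. -/
theorem hasDerivAt_rayMax [NeZero N] [IsFiniteMeasure (volume.restrict Ω)] (hp : 1 < p)
    (hs : 0 < s) (hu : u ∈ nehari Ω s p) (hv : v ∈ W0 Ω s p) :
    HasDerivAt (fun t : ℝ => rayMax Ω s p (u + t • v)) (firstVariation Ω s p u v) 0 := by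
  have hm := normPow_pos (by linarith) hu.1
  have hu0 : u + (0 : ℝ) • v = u := by simp
  have hM := hasDerivAt_normPow (Ω := Ω) hp hu.1.1 hv
  have hratio := (hasDerivAt_nehariFunctional hp hs hu.1.1 hv).div hM (by simpa using hm.ne')
  have hscale := hratio.exp.rpow_const (p := p) (Or.inl (Real.exp_pos _).ne')
  refine ((hscale.mul hM).const_mul (1 / p ^ 2)).congr_deriv ?_
  simp only [Pi.div_apply, hu0, hu.2, zero_div, Real.exp_zero, Real.one_rpow]
  field_simp
  ring

theorem isCriticalPoint_of_isMinOn [NeZero N] [IsFiniteMeasure (volume.restrict Ω)] (hp : 1 < p)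
    (hs : 0 < s) (hu : u ∈ nehari Ω s p) (hmin : IsMinOn (energy Ω s p) (nehari Ω s p) u) :
    IsCriticalPoint Ω s p u := by
  refine (isCriticalPoint_iff_isStationarySolution hp hs).2 <|
    isStationarySolution_iff_firstVariation.2 ⟨hu.1.1, fun v hv => ?_⟩
  refine IsLocalMin.hasDerivAt_eq_zero ?_ (hasDerivAt_rayMax hp hs hu hv)
  filter_upwards [eventually_add_smul_mem_X0 hp hu.1 hv] with t ht
  rw [zero_smul, add_zero, rayMax_of_mem_nehari hu]
  exact energy_le_rayMax_of_isMinOn hp.le hs hmin ht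

theorem isGroundState_of_isMinOn [NeZero N] [IsFiniteMeasure (volume.restrict Ω)] (hp : 1 < p)
    (hs : 0 < s) (hu : u ∈ nehari Ω s p) (hmin : IsMinOn (energy Ω s p) (nehari Ω s p) u) :
    IsGroundState Ω s p u :=
  ⟨hu.1, (isCriticalPoint_iff_isStationarySolution hp hs).1
    (isCriticalPoint_of_isMinOn hp hs hu hmin),
    fun _ hw hsol => hmin (mem_nehari_of_isStationarySolution (by linarith) hw hsol)⟩

end CriticalPoint

section TestFunction

theorem lintegral_lintegral_mul_sub {G : Type*} [AddCommGroup G] [MeasurableSpace G]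
    [MeasurableAdd₂ G] [MeasurableNeg G] {μ : Measure G} [μ.IsAddLeftInvariant]
    [μ.IsNegInvariant] {f k : G → ENNReal} (hf : Measurable f) (hk : Measurable k) :
    ∫⁻ x, ∫⁻ y, f x * k (x - y) ∂μ ∂μ = (∫⁻ x, f x ∂μ) * ∫⁻ z, k z ∂μ := by
  have hinner x : ∫⁻ y, f x * k (x - y) ∂μ = f x * ∫⁻ z, k z ∂μ := by
    rw [lintegral_const_mul _ (by fun_prop), lintegral_sub_left_eq_self k x]
  simp only [hinner, lintegral_mul_const _ hf]

theorem lintegral_lintegral_mul_sub_swap {G : Type*} [AddCommGroup G] [MeasurableSpace G]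
    [MeasurableAdd₂ G] [MeasurableNeg G] {μ : Measure G} [SFinite μ] [μ.IsAddRightInvariant]
    {f k : G → ENNReal} (hf : Measurable f) (hk : Measurable k) :
    ∫⁻ x, ∫⁻ y, f y * k (x - y) ∂μ ∂μ = (∫⁻ x, f x ∂μ) * ∫⁻ z, k z ∂μ := by
  have hinner y : ∫⁻ x, f y * k (x - y) ∂μ = f y * ∫⁻ z, k z ∂μ := by
    rw [lintegral_const_mul _ (by fun_prop), lintegral_sub_right_eq_self k y]
  rw [lintegral_lintegral_swap (by fun_prop)]
  simp only [hinner, lintegral_mul_const _ hf]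

variable {N : ℕ} {s p : ℝ}

theorem integrable_min_norm_one_rpow_div [NeZero N] (hs : 0 < s) (hs1 : s < 1) (hp : 0 < p) :
    Integrable fun z : EuclideanSpace ℝ (Fin N) =>
      min ‖z‖ 1 ^ p / ‖z‖ ^ ((N : ℝ) + s * p) := by
  rw [integrable_fun_norm_addHaar (volume : Measure (EuclideanSpace ℝ (Fin N)))
    (f := fun t => min t 1 ^ p / t ^ ((N : ℝ) + s * p)), finrank_euclideanSpace_fin,
    ← Set.Ioc_union_Ioi_eq_Ioi zero_le_one]
  have hpow {t : ℝ} (ht : 0 < t) : t ^ ((N : ℝ) + s * p) = t ^ (N - 1) * t ^ (1 + s * p) := by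
    rw [← Real.rpow_natCast, ← Real.rpow_add ht, Nat.cast_sub NeZero.one_le]
    congr 1
    push_cast
    ring
  refine IntegrableOn.union ?_ ?_
  · have hnear : IntegrableOn (fun t : ℝ => t ^ (p - (1 + s * p))) (Set.Ioc 0 1) := by
      rw [integrableOn_Ioc_iff_integrableOn_Ioo,
        intervalIntegral.integrableOn_Ioo_rpow_iff zero_lt_one]
      linarith [mul_lt_of_lt_one_left hp hs1]
    refine hnear.congr_fun (fun t ht => ?_) measurableSet_Ioc
    have ht0 : 0 < t := ht.1
    simp only [smul_eq_mul]
    rw [min_eq_left ht.2, hpow ht0, Real.rpow_sub ht0]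
    field_simp
  · have hfar : IntegrableOn (fun t : ℝ => t ^ (-(1 + s * p))) (Set.Ioi 1) :=
      integrableOn_Ioi_rpow_of_lt (by linarith [mul_pos hs hp]) zero_lt_one
    refine hfar.congr_fun (fun t ht => ?_) measurableSet_Ioi
    have ht0 : 0 < t := zero_lt_one.trans ht
    simp only [smul_eq_mul]
    rw [min_eq_right ht.le, hpow ht0, Real.one_rpow, Real.rpow_neg ht0.le]
    field_simp

theorem exists_abs_sub_le_mul_min {E : Type*} [NormedAddCommGroup E] {u : E → ℝ} {C : NNReal}
    (hu : LipschitzWith C u) (hsupp : HasCompactSupport u) :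
    ∃ D, 0 ≤ D ∧ ∀ x y, |u x - u y| ≤ D * min ‖x - y‖ 1 := by
  obtain ⟨M, hM⟩ := hu.continuous.bounded_above_of_compact_support hsupp
  have hM0 : 0 ≤ M := (norm_nonneg _).trans (hM 0)
  refine ⟨C + 2 * M, by positivity, fun x y => ?_⟩
  rw [mul_min_of_nonneg _ _ (by positivity), mul_one]
  refine le_min ?_ ?_
  · calc |u x - u y| ≤ C * ‖x - y‖ := by simpa [Real.dist_eq, dist_eq_norm] using hu.dist_le_mul x y
      _ ≤ (C + 2 * M) * ‖x - y‖ := by gcongr; linarith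
  · calc |u x - u y| ≤ |u x| + |u y| := abs_sub _ _
      _ ≤ M + M := add_le_add (hM x) (hM y)
      _ ≤ C + 2 * M := by linarith [C.coe_nonneg]

theorem gagliardoPow_lt_top_of_lipschitzWith [NeZero N] (hs : 0 < s) (hs1 : s < 1) (hp : 0 < p)
    {u : EuclideanSpace ℝ (Fin N) → ℝ} {C : NNReal} (hu : LipschitzWith C u)
    (hsupp : HasCompactSupport u) : gagliardoPow N s p u < ⊤ := by
  obtain ⟨D, hD0, hD⟩ := exists_abs_sub_le_mul_min hu hsupp
  set k : EuclideanSpace ℝ (Fin N) → ENNReal := fun z =>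
    ENNReal.ofReal (D ^ p * (min ‖z‖ 1 ^ p / ‖z‖ ^ ((N : ℝ) + s * p)))
  set f : EuclideanSpace ℝ (Fin N) → ENNReal := (tsupport u).indicator 1
  have hk : Measurable k := by fun_prop
  have hf : Measurable f := measurable_one.indicator (isClosed_tsupport u).measurableSet
  have hfin : (∫⁻ x, f x) * ∫⁻ z, k z < ⊤ := by
    refine ENNReal.mul_lt_top ?_
      ((integrable_min_norm_one_rpow_div hs hs1 hp).const_mul (D ^ p)).lintegral_lt_top
    rw [lintegral_indicator_one (isClosed_tsupport u).measurableSet]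
    exact hsupp.measure_lt_top
  have hle x y : ENNReal.ofReal (|u x - u y| ^ p / ‖x - y‖ ^ ((N : ℝ) + s * p)) ≤
      f x * k (x - y) + f y * k (x - y) := by
    by_cases hxy : x ∉ tsupport u ∧ y ∉ tsupport u
    · simp [image_eq_zero_of_notMem_tsupport hxy.1, image_eq_zero_of_notMem_tsupport hxy.2,
        Real.zero_rpow hp.ne']
    calc ENNReal.ofReal (|u x - u y| ^ p / ‖x - y‖ ^ ((N : ℝ) + s * p)) ≤ k (x - y) := by
          refine ENNReal.ofReal_le_ofReal ?_
          rw [← mul_div_assoc, ← Real.mul_rpow hD0 (by positivity)]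
          gcongr
          exact hD x y
      _ ≤ f x * k (x - y) + f y * k (x - y) := by
          rcases not_and_or.1 hxy with h | h <;> simp [f, not_not.1 h]
  calc gagliardoPow N s p u
      ≤ ∫⁻ x, ∫⁻ y, (f x * k (x - y) + f y * k (x - y)) :=
        lintegral_mono fun x => lintegral_mono fun y => hle x y
    _ = (∫⁻ x, ∫⁻ y, f x * k (x - y)) + ∫⁻ x, ∫⁻ y, f y * k (x - y) := by
        rw [← lintegral_add_left (by fun_prop)]
        exact lintegral_congr fun x => lintegral_add_left (by fun_prop) _
    _ = (∫⁻ x, f x) * (∫⁻ z, k z) + (∫⁻ x, f x) * ∫⁻ z, k z := by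
        rw [lintegral_lintegral_mul_sub hf hk, lintegral_lintegral_mul_sub_swap hf hk]
    _ < ⊤ := ENNReal.add_lt_top.2 ⟨hfin, hfin⟩

theorem X0_nonempty [NeZero N] (hs : 0 < s) (hs1 : s < 1) (hp : 0 < p)
    {Ω : Set (EuclideanSpace ℝ (Fin N))} (hΩ : (interior Ω).Nonempty) : (X0 Ω s p).Nonempty := by
  obtain ⟨c, hc⟩ := hΩ
  obtain ⟨u, hsub, hsupp, hsmooth, -, huc⟩ :=
    exists_contDiff_tsupport_subset (n := 1) (mem_interior_iff_mem_nhds.1 hc)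
  obtain ⟨C, hlip⟩ := hsmooth.lipschitzWith_of_hasCompactSupport hsupp (by simp)
  refine ⟨u, ⟨hsmooth.continuous.memLp_of_hasCompactSupport hsupp,
    gagliardoPow_lt_top_of_lipschitzWith hs hs1 hp hlip hsupp,
    .of_forall fun x hx => image_eq_zero_of_notMem_tsupport fun h => hx (hsub h)⟩, fun h => ?_⟩
  have hzero : u = 0 := (hsmooth.continuous.ae_eq_iff_eq volume continuous_zero).1 h
  simp [hzero] at huc

end TestFunction

end FracLog

end

theorem mainTheorem4_general (N : ℕ) [NeZero N] (s p : ℝ) (hs0 : 0 < s) (hs1 : s < 1) (hp : 1 < p)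
    (Ω : Set (EuclideanSpace ℝ (Fin N))) (hΩb : Bornology.IsBounded Ω)
    (hΩi : (interior Ω).Nonempty) :
    (FracLog.depth Ω s p
        = ⨅ u ∈ FracLog.X0 Ω s p, ⨆ (l : ℝ) (_ : 0 < l), (FracLog.energy Ω s p (l • u) : EReal)) ∧
    (∀ ε γ : ℝ, 0 < ε → ε ≤ 1 → 1 < γ →
      (∃ C : ℝ, FracLog.LogEstimate Ω s p ε γ C) ∧
      ∀ C : ℝ, FracLog.LogEstimate Ω s p ε γ C →
        0 < FracLog.radius p γ C ^ p / p ^ 2 ∧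
        ((FracLog.radius p γ C ^ p / p ^ 2 : ℝ) : EReal) ≤ FracLog.depth Ω s p) ∧
    (∃ u ∈ FracLog.nehari Ω s p, (FracLog.energy Ω s p u : EReal) = FracLog.depth Ω s p ∧
      FracLog.IsCriticalPoint Ω s p u ∧ FracLog.IsGroundState Ω s p u) := by
  have hp0 : 0 < p := by linarith
  have : IsFiniteMeasure (volume.restrict Ω) :=
    isFiniteMeasure_restrict.2 hΩb.measure_lt_top.ne
  refine ⟨FracLog.depth_eq_iInf_iSup hp.le hs0, fun ε γ hε hε1 hγ => ?_, ?_⟩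
  · exact ⟨FracLog.exists_logEstimate Ω hp.le hs0 hε hγ, fun C hC =>
      ⟨div_pos (FracLog.radius_rpow_pos hC.1) (pow_pos hp0 2),
        FracLog.le_depth_of_logEstimate hp0 hε1 hγ hC⟩⟩
  · obtain ⟨u, hu, hmin⟩ := FracLog.exists_isMinOn_energy_nehari hp hs0 hΩb
      (FracLog.X0_nonempty hs0 hs1 hp0 hΩi)
    exact ⟨u, hu, FracLog.energy_eq_depth hu hmin,
      FracLog.isCriticalPoint_of_isMinOn hp hs0 hu hmin,
      FracLog.isGroundState_of_isMinOn hp hs0 hu hmin⟩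

theorem mainTheorem4 (N : ℕ) (s p : ℝ) (hs0 : 0 < s) (hs1 : s < 1) (hp : 2 ≤ p)
    (hN : s * p < (N : ℝ)) (Ω : Set (EuclideanSpace ℝ (Fin N))) (hΩo : IsOpen Ω)
    (hΩb : Bornology.IsBounded Ω) (hΩn : Ω.Nonempty) :
    (FracLog.depth Ω s p
        = ⨅ u ∈ FracLog.X0 Ω s p, ⨆ (l : ℝ) (_ : 0 < l), (FracLog.energy Ω s p (l • u) : EReal)) ∧
    (∀ ϱ θ γ : ℝ, 0 < ϱ → ϱ < s * p ^ 2 / N →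
      1 / (p + ϱ) = (1 - θ) / p + θ / (N * p / (N - s * p)) →
      γ = (1 - θ) * (p + ϱ) / (p - θ * (p + ϱ)) →
      (∃ C : ℝ, FracLog.LogEstimate Ω s p (1 / 2) γ C) ∧
      ∀ C : ℝ, FracLog.LogEstimate Ω s p (1 / 2) γ C →
        0 < FracLog.radius p γ C ^ p / p ^ 2 ∧
        ((FracLog.radius p γ C ^ p / p ^ 2 : ℝ) : EReal) ≤ FracLog.depth Ω s p) ∧
    (∃ u ∈ FracLog.nehari Ω s p, (FracLog.energy Ω s p u : EReal) = FracLog.depth Ω s p ∧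
      FracLog.IsCriticalPoint Ω s p u ∧ FracLog.IsGroundState Ω s p u) := by
  have hp0 : 0 < p := by linarith
  have : NeZero N := ⟨by rintro rfl; exact absurd hN (by simpa using (mul_pos hs0 hp0).le)⟩
  obtain ⟨hdepth, hlog, hmin⟩ := mainTheorem4_general N s p hs0 hs1 (by linarith) Ω hΩb
    (by rwa [hΩo.interior_eq])
  exact ⟨hdepth, fun ϱ θ γ hϱ hϱ' hθ hγ => hlog _ γ one_half_pos (by norm_num)
    (FracLog.one_lt_interpolation_exponent hs0 hp0 hN hϱ hϱ' hθ hγ), hmin⟩
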